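/- Let $\mathbb T=[-\pi,\pi]^3$ with periodic boundary conditions, $\gamma>0$ and $g\in[L^2(\mathbb T)]^3$. Let $\mathcal H_0$ be the closed subspace of divergence free fields (in the sense of distributions) in $[L^2(\mathbb T)]^3$, with the $L^2$ norm and inner product $(\cdot,\cdot)$, and let $\Pi$ be the orthogonal (Leray) projector of $[L^2(\mathbb T)]^3$ onto $\mathcal H_0$. For $\alpha>0$ let $\mathcal H_\alpha=\{v\in[H^1(\mathbb T)]^3:\operatorname{div}v=0\}$ with $\|v\|_{\mathcal H_\alpha}^2=\|v\|_{L^2}^2+\alpha\|\nabla v\|_{L^2}^2$. The damped Bardina–Euler equation with parameter $\alpha>0$ is $$\partial_t\bar u-\alpha\partial_t\Delta\bar u+(\bar u,\nabla)\bar u+\nabla p+\gamma(\bar u-\alpha\Delta\bar u)=g,\qquad \operatorname{div}\bar u=0;$$ its solutions are the functions $\bar u\in C^1([0,\infty);\mathcal H_\alpha)$ that satisfy it in the sense of distributions against smooth divergence free test fields, for every $t\ge0$. For a function $\tilde u:[0,\infty)\to\mathcal H_0$, an *approximating sequence* of $\tilde u$ is a sequence $\alpha_n>0$, $\alpha_n\to0$,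 with solutions $\bar u_n$ of the damped Bardina–Euler equation with parameter $\alpha_n$, such that $\|\bar u_n(0)\|_{\mathcal H_{\alpha_n}}$ is bounded uniformly in $n$ and $\bar u_n(t)\rightharpoonup\tilde u(t)$ weakly in $\mathcal H_0$ for every $t\ge0$. Let $\mathcal K_0^+$ be the set of all $\tilde u$ that have an approximating sequence. For a smooth divergence free field $\varphi=\varphi(t,x)$ on $[0,\infty)\times\mathbb T$ and $t\ge0$ put $$M_{\tilde u,\varphi}(t)=\inf\ \liminf_{n\to\infty}\|\bar u_n(t)-\varphi(t)\|^2_{\mathcal H_{\alpha_n}},$$ the infimum being over all approximating sequences of $\tilde u$, and $$e_0(\varphi)(t)=\sup_{0\ne z\in\mathcal H_0}\frac{-((z,\nabla)\varphi(t),z)}{\|z\|_{\mathcal H_0}^2},\qquad D_0(\varphi)=\partial_t\varphi+\Pi(\varphi,\nabla)\varphi+\gamma\varphi-\Pi g .$$ Let $(T(h)v)(t)=v(t+h)$ for $h\ge0$. **Proposition.** Let $\tilde u\in\mathcal K_0^+$ and let $\varphi$ be a smooth divergence free field on $[0,\infty)\times\mathbb T$. Then $M_{\tilde u,\varphi}(t)$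 is finite for all $t\ge0$, and: 1. $\|\tilde u(t)-\varphi(t)\|^2_{\mathcal H_0}\le M_{\tilde u,\varphi}(t)$ for all $t\ge0$; 2. $M_{\tilde u,\varphi}(t)=M_{\tilde u,0}(t)+\|\varphi(t)\|^2_{\mathcal H_0}-2(\tilde u(t),\varphi(t))$ for all $t\ge0$; 3. $M_{T(h)\tilde u,T(h)\varphi}(t)\le M_{\tilde u,\varphi}(t+h)$ for all $t,h\ge0$; 4. for all $t,\kappa\ge0$ the integrands below are integrable and $$M_{\tilde u,\varphi}(t+\kappa)\le M_{\tilde u,\varphi}(t)\,e^{-2\int_t^{t+\kappa}(\gamma-e_0(\varphi)(s))\,ds}-2\int_t^{t+\kappa}e^{-2\int_\tau^{t+\kappa}(\gamma-e_0(\varphi)(s))\,ds}\,(D_0(\varphi)(\tau),\tilde u(\tau)-\varphi(\tau))\,d\tau .$$ -/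

import Mathlib

open Filter Topology MeasureTheory Set
open scoped ContDiff

namespace DampedEuler

noncomputable section

instance factTwoPiPos : Fact ((0 : ℝ) < 2 * Real.pi) := ⟨Real.two_pi_pos⟩

/-- Velocity vectors. -/
abbrev E3 : Type := EuclideanSpace ℝ (Fin 3)

/-- The torus `[-π, π]³` with opposite faces identified; its `volume` is Lebesgue measure, of total
mass `(2π)³`. -/
abbrev Torus : Type := Fin 3 → AddCircle (2 * Real.pi)

/-- `[L²(𝕋)]³`, a real Hilbert space. -/
abbrev L2 : Type := Lp E3 2 (volume : Measure Torus)

/-- The covering map `ℝ³ → 𝕋`. -/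
def toTorus (y : Fin 3 → ℝ) : Torus := fun i => (y i : AddCircle (2 * Real.pi))

/-- A function on the torus is smooth iff its periodic lift to `ℝ³` is `C^∞`. -/
def IsSmooth {F : Type} [NormedAddCommGroup F] [NormedSpace ℝ F] (f : Torus → F) : Prop :=
  ContDiff ℝ ∞ (fun y : Fin 3 → ℝ => f (toTorus y))

/-- The classical partial derivative `∂ᵢ f` of a function on the torus. -/
def pderiv {F : Type} [NormedAddCommGroup F] [NormedSpace ℝ F] (i : Fin 3) (f : Torus → F) :
    Torus → F :=
  fun x => deriv (fun s : ℝ => f (x + Pi.single i (s : AddCircle (2 * Real.pi)))) 0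

theorem continuous_toTorus : Continuous toTorus :=
  continuous_pi fun i => (AddCircle.continuous_mk' _).comp (continuous_apply i)

theorem isOpenQuotientMap_toTorus : IsOpenQuotientMap toTorus :=
  IsOpenQuotientMap.piMap (f := fun (_ : Fin 3) (s : ℝ) => (s : AddCircle (2 * Real.pi)))
    fun _ => QuotientAddGroup.isOpenQuotientMap_mk

theorem IsSmooth.continuous {F : Type} [NormedAddCommGroup F] [NormedSpace ℝ F] {f : Torus → F}
    (hf : IsSmooth f) : Continuous f :=
  isOpenQuotientMap_toTorus.isQuotientMap.continuous_iff.2 (ContDiff.continuous hf)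

theorem memLp_of_continuous {f : Torus → E3} (hf : Continuous f) :
    MemLp f 2 (volume : Measure Torus) :=
  hf.memLp_of_hasCompactSupport (HasCompactSupport.of_compactSpace f)

open scoped Classical in
/-- The `L²` class of a square-integrable vector field (it is only used for continuous fields, which
are square-integrable by `memLp_of_continuous`). -/
def toL2 (f : Torus → E3) : L2 :=
  if h : MemLp f 2 (volume : Measure Torus) then h.toLp f else 0

/-- The gradient of a scalar function. -/
def grad (q : Torus → ℝ) : Torus → E3 :=
  fun x => WithLp.toLp 2 (fun i => pderiv i q x)

/-- `𝓗₀`: the square-integrable fields `u` with `div u = 0` in the sense of distributions, i.e.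
`(u, ∇q) = 0` for all smooth `q`. -/
def H0 : Submodule ℝ L2 :=
  (Submodule.span ℝ {v : L2 | ∃ q : Torus → ℝ, IsSmooth q ∧ v = toL2 (grad q)})ᗮ

instance completeSpaceH0 : CompleteSpace H0 :=
  (Submodule.isClosed_orthogonal _).completeSpace_coe

instance hasOrthogonalProjectionH0 : H0.HasOrthogonalProjection :=
  Submodule.HasOrthogonalProjection.ofCompleteSpace H0

/-- The Leray projector `Π`: the orthogonal projector of `[L²(𝕋)]³` onto `𝓗₀`. -/
def leray : L2 →L[ℝ] L2 := H0.starProjection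

/-- `v = ∂ᵢ u` in the sense of distributions. -/
def HasWeakPDeriv (i : Fin 3) (u v : L2) : Prop :=
  ∀ ψ : Torus → E3, IsSmooth ψ → inner ℝ u (toL2 (pderiv i ψ)) = -inner ℝ v (toL2 ψ)

open scoped Classical in
/-- The weak derivative `∂ᵢ u ∈ L²` (zero if there is none). -/
def wderiv (i : Fin 3) (u : L2) : L2 :=
  if h : ∃ v, HasWeakPDeriv i u v then h.choose else 0

/-- The divergence free fields of class `H¹`, the underlying space of `𝓗_α` for `α > 0`. -/
def H1 : Set L2 := {u | u ∈ H0 ∧ ∀ i, ∃ v, HasWeakPDeriv i u v}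

/-- `‖u‖²_{𝓗_α} = ‖u‖²_{L²} + α ‖∇u‖²_{L²}`. -/
def normSqH (α : ℝ) (u : L2) : ℝ := ‖u‖ ^ 2 + α * ∑ i, ‖wderiv i u‖ ^ 2

/-- `∑ᵢ vᵢ Gᵢ`; thus `(v, ∇)w = adv v (∂₁w, ∂₂w, ∂₃w)`. -/
def adv (v : Torus → E3) (G : Fin 3 → Torus → E3) : Torus → E3 :=
  fun x => ∑ i, v x i • G i x

/-- A smooth divergence free vector field on the torus. -/
structure IsSolenoidal (ψ : Torus → E3) : Prop where
  smooth : IsSmooth ψ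
  div_free : ∀ x, ∑ i, pderiv i (fun y => ψ y i) x = 0

/-- `u ∈ C¹([0, ∞); 𝓗_α)` is a solution of
`∂ₜu - α ∂ₜΔu + (u, ∇)u + ∇p + γ (u - α Δu) = g`, `div u = 0`.
The equation is understood in the sense of distributions on `𝕋` for every `t`, and the pressure is
eliminated by taking divergence free test fields. Only the values `u t` with `t ≥ 0` matter. Being
`C¹` with values in `𝓗_α` means that `u` and its weak derivatives are `C¹` with values in `L²`. -/
structure IsBardinaSolution (γ α : ℝ) (g : L2) (u : ℝ → L2) : Prop where
  mem : ∀ t, 0 ≤ t → u t ∈ H1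
  contDiff : ContDiffOn ℝ 1 u (Ici 0)
  contDiff_grad : ∀ i, ContDiffOn ℝ 1 (fun t => wderiv i (u t)) (Ici 0)
  eqn : ∀ t, 0 ≤ t → ∀ ψ : Torus → E3, IsSolenoidal ψ →
    inner ℝ (derivWithin u (Ici 0) t) (toL2 ψ)
      + α * ∑ i, inner ℝ (derivWithin (fun s => wderiv i (u s)) (Ici 0) t) (toL2 (pderiv i ψ))
      + (∫ x, inner ℝ (adv (u t) (fun i => wderiv i (u t)) x) (ψ x))
      + γ * (inner ℝ (u t) (toL2 ψ)
          + α * ∑ i, inner ℝ (wderiv i (u t)) (toL2 (pderiv i ψ)))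
    = inner ℝ g (toL2 ψ)

/-- The sequences `(αₙ, uₙ)` with `αₙ > 0`, `αₙ → 0`, where `uₙ` solves the Bardina-Euler equations
with parameter `αₙ`, the numbers `‖uₙ(0)‖_{𝓗_{αₙ}}` are bounded, and `uₙ(t) ⇀ ũ(t)` weakly in `𝓗₀`
for every `t ≥ 0`. -/
structure Approximates (γ : ℝ) (g : L2) (α : ℕ → ℝ) (u : ℕ → ℝ → L2) (ũ : ℝ → L2) : Prop where
  pos : ∀ n, 0 < α n
  tendsto_zero : Tendsto α atTop (𝓝 0)
  solution : ∀ n, IsBardinaSolution γ (α n) g (u n)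
  bounded : ∃ C : ℝ, ∀ n, normSqH (α n) (u n 0) ≤ C
  weak : ∀ t, 0 ≤ t → ∀ w ∈ H0, Tendsto (fun n => inner ℝ (u n t) w) atTop (𝓝 (inner ℝ (ũ t) w))

/-- The trajectory phase space `𝓚₀⁺` (trajectories are functions of `t ≥ 0`; values at negative
times are irrelevant). -/
def K0plus (γ : ℝ) (g : L2) : Set (ℝ → L2) :=
  {ũ | (∀ t, 0 ≤ t → ũ t ∈ H0) ∧ ∃ α u, Approximates γ g α u ũ}

/-- A smooth divergence free test function `φ = φ(t, x)` on `[0, ∞) × 𝕋`. -/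
structure IsTestField (φ : ℝ → Torus → E3) : Prop where
  smooth : ContDiffOn ℝ ∞ (fun p : ℝ × (Fin 3 → ℝ) => φ p.1 (toTorus p.2)) (Ici 0 ×ˢ univ)
  div_free : ∀ t, 0 ≤ t → ∀ x, ∑ i, pderiv i (fun y => φ t y i) x = 0

/-- The `M`-functional `M_{ũ,φ}(t)`: the infimum over all approximating sequences of
`liminf ‖uₙ(t) - φ(t)‖²_{𝓗_{αₙ}}`, as an extended real number. -/
def M (γ : ℝ) (g : L2) (ũ : ℝ → L2) (φ : ℝ → Torus → E3) (t : ℝ) : EReal :=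
  ⨅ (α : ℕ → ℝ) (u : ℕ → ℝ → L2) (_ : Approximates γ g α u ũ),
    liminf (fun n => ((normSqH (α n) (u n t - toL2 (φ t)) : ℝ) : EReal)) atTop

/-- `e₀(φ)(t) = sup_{0 ≠ z ∈ 𝓗₀} -((z, ∇)φ(t), z) / ‖z‖²`. -/
def e0 (φ : ℝ → Torus → E3) (t : ℝ) : ℝ :=
  ⨆ z : {z : L2 // z ∈ H0 ∧ z ≠ 0},
    -(∫ x, inner ℝ (adv z.1 (fun i => pderiv i (φ t)) x) (z.1 x)) / ‖z.1‖ ^ 2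

/-- `D₀(φ)(t) = ∂ₜφ + Π(φ, ∇)φ + γ φ - Π g`. -/
def D0 (γ : ℝ) (g : L2) (φ : ℝ → Torus → E3) (t : ℝ) : L2 :=
  toL2 (fun x => derivWithin (fun s => φ s x) (Ici 0) t)
    + leray (toL2 (adv (φ t) (fun i => pderiv i (φ t))))
    + γ • toL2 (φ t) - leray g

/-- The time shift `(T(h)u)(t) = u(t + h)`. -/
def shift {X : Type} (h : ℝ) (u : ℝ → X) : ℝ → X := fun t => u (t + h)

/-- The integrand `e^{-2∫_τ^b (γ - e₀(φ)(s)) ds} (D₀(φ)(τ), ũ(τ) - φ(τ))` of the dissipative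
variational inequality on a time interval with right end `b`. -/
def dissIntegrand (γ : ℝ) (g : L2) (ũ : ℝ → L2) (φ : ℝ → Torus → E3) (b τ : ℝ) : ℝ :=
  Real.exp (-2 * ∫ s in τ..b, (γ - e0 φ s)) * inner ℝ (D0 γ g φ τ) (ũ τ - toL2 (φ τ))

end

end DampedEuler

open DampedEuler

/-! The heart of the matter is a relative energy estimate for one Bardina–Euler solution `u`. Put `w
= u - φ` and `E = ‖w‖²` in the norm of `𝓗_α`. Subtracting the equation tested with `φ` from the
energy identity gives `E' = -2γE - 2 ∑ᵢ ∫ wᵢ (w · ∂ᵢφ) - 2 (D₀(φ), w) - 2α R`, where `R` pairs `γ∇φ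
+ ∂ₜ∇φ` with `∇w` (`IsBardinaSolution.hasDerivWithinAt_relative`). The quadratic term is controlled
by `e₀(φ)`. The last term is of order `√α`, because the energy estimate bounds `α‖∇w‖²` uniformly in
`α` on bounded time intervals. An integrating factor then yields Gronwall's inequality with an error
`√α B` (`relative_energy_le`). Apart from the initial value of `E`, its right side is affine in `u`,
so it passes to the pointwise weak limit by dominated convergence. The comparison principle
`M_le_mul_add` turns an inequality valid along every approximating sequence into one for `M`, and
this gives item 4.

The other items are softer. Item 1 is weak lower semicontinuity of the `L²` norm. Item 2 expands the
square; its gradient cross terms carry a factor `α` and vanish in the limit. Item 3 holds because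
shifting an approximating sequence gives an approximating sequence of the shifted trajectory.
Finiteness comes from the energy bound.

The energy identity requires testing the equation with `u(t)` itself, which is only of class `H¹`.
This rests on two facts proved from scratch. First, a divergence free `H¹` field is an `H¹` limit of
smooth divergence free fields: project onto finite dimensional spaces of trigonometric fields that
are stable under differentiation (`exists_solenoidal_near`). Second, the trilinear form is
continuous in the `H¹` norm, by the embedding of `H¹` in `L⁴`; this is derived through `L⁶` from the
Gagliardo–Nirenberg grid inequality (`integral_cube_sq_le`). -/

namespace DampedEuler

/-! ### Differential calculus and integration by parts on the torus. -/

section Calculus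

theorem integrable_of_continuous {F : Type} [NormedAddCommGroup F] {f : Torus → F}
    (hf : Continuous f) :
    Integrable f (volume : Measure Torus) :=
  hf.integrable_of_hasCompactSupport (HasCompactSupport.of_compactSpace f)

theorem exists_bound_of_continuous {F : Type} [NormedAddCommGroup F] {f : Torus → F}
    (hf : Continuous f) :
    ∃ C, 0 ≤ C ∧ ∀ x, ‖f x‖ ≤ C := by
  obtain ⟨C, hC⟩ := isCompact_univ.exists_bound_of_continuousOn hf.continuousOn
  exact ⟨C, (norm_nonneg _).trans (hC 0 (mem_univ _)), fun x => hC x (mem_univ _)⟩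

variable {F G : Type} [NormedAddCommGroup F] [NormedSpace ℝ F] [NormedAddCommGroup G]
  [NormedSpace ℝ G]

theorem toTorus_surjective : Function.Surjective toTorus :=
  isOpenQuotientMap_toTorus.surjective

theorem toTorus_add_single (y : Fin 3 → ℝ) (i : Fin 3) (s : ℝ) :
    toTorus y + Pi.single i (s : AddCircle (2 * Real.pi)) = toTorus (y + s • Pi.single i 1) := by
  funext j
  by_cases h : j = i
  · subst h; simp [toTorus]
  · simp [toTorus, h]

theorem hasDerivAt_comp_line {f : (Fin 3 → ℝ) → F} (y e : Fin 3 → ℝ) (s : ℝ)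
    (hf : DifferentiableAt ℝ f (y + s • e)) :
    HasDerivAt (fun s : ℝ => f (y + s • e)) (fderiv ℝ f (y + s • e) e) s := by
  have h1 : HasDerivAt (fun s : ℝ => y + s • e) e s := by
    simpa using ((hasDerivAt_id s).smul_const e).const_add y
  exact hf.hasFDerivAt.comp_hasDerivAt s h1

theorem IsSmooth.differentiable {f : Torus → F} (hf : IsSmooth f) :
    Differentiable ℝ (fun y : Fin 3 → ℝ => f (toTorus y)) :=
  ContDiff.differentiable hf (by simp)

theorem IsSmooth.pderiv_toTorus {f : Torus → F} (hf : IsSmooth f) (i : Fin 3) (y : Fin 3 → ℝ) :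
    pderiv i f (toTorus y) = fderiv ℝ (fun y : Fin 3 → ℝ => f (toTorus y)) y (Pi.single i 1) := by
  have h := hasDerivAt_comp_line (f := fun y : Fin 3 → ℝ => f (toTorus y)) y (Pi.single i 1) 0
    (hf.differentiable _)
  simp only [pderiv, toTorus_add_single]
  simpa using h.deriv

theorem IsSmooth.hasDerivAt_line {f : Torus → F} (hf : IsSmooth f) (i : Fin 3) (x : Torus)
    (s : ℝ) :
    HasDerivAt (fun s : ℝ => f (x + Pi.single i (s : AddCircle (2 * Real.pi))))
      (pderiv i f (x + Pi.single i (s : AddCircle (2 * Real.pi)))) s := by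
  obtain ⟨y, rfl⟩ := toTorus_surjective x
  simp only [toTorus_add_single]
  rw [hf.pderiv_toTorus]
  exact hasDerivAt_comp_line (f := fun y : Fin 3 → ℝ => f (toTorus y)) y (Pi.single i 1) s
    (hf.differentiable _)

theorem IsSmooth.hasDerivAt_pderiv {f : Torus → F} (hf : IsSmooth f) (i : Fin 3) (x : Torus) :
    HasDerivAt (fun s : ℝ => f (x + Pi.single i (s : AddCircle (2 * Real.pi))))
      (pderiv i f x) 0 := by
  simpa using hf.hasDerivAt_line i x 0

theorem IsSmooth.pderiv {f : Torus → F} (hf : IsSmooth f) (i : Fin 3) :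
    IsSmooth (DampedEuler.pderiv i f) := by
  unfold IsSmooth
  simp only [hf.pderiv_toTorus]
  exact (ContDiff.fderiv_right (m := ∞) hf (by simp)).clm_apply contDiff_const

theorem IsSmooth.const (c : F) : IsSmooth (fun _ : Torus => c) := contDiff_const

theorem pderiv_const (i : Fin 3) (c : F) :
    DampedEuler.pderiv i (fun _ : Torus => c) = fun _ => 0 := by
  funext x; simp [DampedEuler.pderiv]

theorem IsSmooth.add {f g : Torus → F} (hf : IsSmooth f) (hg : IsSmooth g) :
    IsSmooth (fun x => f x + g x) := ContDiff.add hf hg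

theorem IsSmooth.sub {f g : Torus → F} (hf : IsSmooth f) (hg : IsSmooth g) :
    IsSmooth (fun x => f x - g x) := ContDiff.sub hf hg

theorem IsSmooth.mul {f g : Torus → ℝ} (hf : IsSmooth f) (hg : IsSmooth g) :
    IsSmooth (fun x => f x * g x) := ContDiff.mul hf hg

theorem IsSmooth.sum {ι : Type} {s : Finset ι} {f : ι → Torus → F}
    (hf : ∀ j ∈ s, IsSmooth (f j)) : IsSmooth (fun x => ∑ j ∈ s, f j x) := ContDiff.sum hf

theorem IsSmooth.clm (L : F →L[ℝ] G) {f : Torus → F} (hf : IsSmooth f) :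
    IsSmooth (fun x => L (f x)) := L.contDiff.comp hf

theorem IsSmooth.inner {f g : Torus → E3} (hf : IsSmooth f) (hg : IsSmooth g) :
    IsSmooth (fun x => inner ℝ (f x) (g x)) := ContDiff.inner ℝ hf hg

theorem IsSmooth.apply {f : Torus → E3} (hf : IsSmooth f) (j : Fin 3) :
    IsSmooth (fun x => f x j) := hf.clm (EuclideanSpace.proj j : E3 →L[ℝ] ℝ)

theorem pderiv_add {f g : Torus → F} (hf : IsSmooth f) (hg : IsSmooth g) (i : Fin 3) :
    pderiv i (fun x => f x + g x) = fun x => pderiv i f x + pderiv i g x :=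
  funext fun x => ((hf.hasDerivAt_pderiv i x).add (hg.hasDerivAt_pderiv i x)).deriv

theorem pderiv_sub {f g : Torus → F} (hf : IsSmooth f) (hg : IsSmooth g) (i : Fin 3) :
    pderiv i (fun x => f x - g x) = fun x => pderiv i f x - pderiv i g x :=
  funext fun x => ((hf.hasDerivAt_pderiv i x).sub (hg.hasDerivAt_pderiv i x)).deriv

theorem pderiv_mul {f g : Torus → ℝ} (hf : IsSmooth f) (hg : IsSmooth g) (i : Fin 3) :
    pderiv i (fun x => f x * g x) = fun x => pderiv i f x * g x + f x * pderiv i g x :=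
  funext fun x => by
    refine ((hf.hasDerivAt_pderiv i x).fun_mul (hg.hasDerivAt_pderiv i x)).deriv.trans ?_
    simp

theorem pderiv_inner {f g : Torus → E3} (hf : IsSmooth f) (hg : IsSmooth g) (i : Fin 3) :
    pderiv i (fun x => inner ℝ (f x) (g x))
      = fun x => inner ℝ (f x) (pderiv i g x) + inner ℝ (pderiv i f x) (g x) :=
  funext fun x => by
    refine ((hf.hasDerivAt_pderiv i x).inner ℝ (hg.hasDerivAt_pderiv i x)).deriv.trans ?_
    simp

theorem pderiv_clm (L : F →L[ℝ] G) {f : Torus → F} (hf : IsSmooth f) (i : Fin 3) :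
    pderiv i (fun x => L (f x)) = fun x => L (pderiv i f x) :=
  funext fun x => (L.hasFDerivAt.comp_hasDerivAt (0 : ℝ) (hf.hasDerivAt_pderiv i x)).deriv

theorem pderiv_apply {f : Torus → E3} (hf : IsSmooth f) (i j : Fin 3) :
    pderiv i (fun x => f x j) = fun x => pderiv i f x j :=
  pderiv_clm (EuclideanSpace.proj j : E3 →L[ℝ] ℝ) hf i

/-- The derivative of a function along a curve of translations has integral zero. -/
theorem integral_eq_zero_of_hasDerivAt_translate {X : Type} [AddGroup X] [MeasurableSpace X]
    [MeasurableAdd X] {μ : Measure X} [IsFiniteMeasure μ] [μ.IsAddRightInvariant] {f f' : X → ℝ}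
    (c : ℝ → X) (hf : Integrable f μ) (hf' : Integrable f' μ) {C : ℝ} (hC : ∀ x, ‖f' x‖ ≤ C)
    (hderiv : ∀ x s, HasDerivAt (fun s => f (x + c s)) (f' (x + c s)) s) :
    ∫ x, f' x ∂μ = 0 := by
  have h := (hasDerivAt_integral_of_dominated_loc_of_deriv_le (μ := μ) (x₀ := (0 : ℝ)) (s := univ)
    (bound := fun _ => C) (F := fun s x => f (x + c s)) (F' := fun s x => f' (x + c s)) univ_mem
    (Eventually.of_forall fun s => (hf.comp_add_right (c s)).aestronglyMeasurable)
    (hf.comp_add_right (c 0)) (hf'.comp_add_right (c 0)).aestronglyMeasurable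
    (Eventually.of_forall fun x s _ => hC _) (integrable_const C)
    (Eventually.of_forall fun x s _ => hderiv x s)).2
  -- Invariance of `μ` makes the differentiated integral constant in `s`, while its derivative is `∫
  -- f'`.
  simp only [integral_add_right_eq_self] at h
  exact h.unique (hasDerivAt_const _ _)

/-- The integral of a partial derivative over the torus vanishes. -/
theorem integral_pderiv {f : Torus → ℝ} (hf : IsSmooth f) (i : Fin 3) :
    ∫ x, pderiv i f x = 0 := by
  obtain ⟨C, -, hC⟩ := exists_bound_of_continuous (hf.pderiv i).continuous
  exact integral_eq_zero_of_hasDerivAt_translate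
    (fun s : ℝ => Pi.single i (s : AddCircle (2 * Real.pi)))
    (integrable_of_continuous hf.continuous) (integrable_of_continuous (hf.pderiv i).continuous)
    hC (hf.hasDerivAt_line i)

theorem integral_mul_pderiv {f g : Torus → ℝ} (hf : IsSmooth f) (hg : IsSmooth g) (i : Fin 3) :
    ∫ x, f x * pderiv i g x = -∫ x, pderiv i f x * g x := by
  have h := integral_pderiv (hf.mul hg) i
  simp only [pderiv_mul hf hg] at h
  rw [integral_add
    (integrable_of_continuous ((hf.pderiv i).continuous.fun_mul hg.continuous))
    (integrable_of_continuous (hf.continuous.fun_mul (hg.pderiv i).continuous))] at h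
  linarith

theorem integral_inner_pderiv {f g : Torus → E3} (hf : IsSmooth f) (hg : IsSmooth g) (i : Fin 3) :
    ∫ x, inner ℝ (f x) (pderiv i g x) = -∫ x, inner ℝ (pderiv i f x) (g x) := by
  have h := integral_pderiv (hf.inner hg) i
  simp only [pderiv_inner hf hg] at h
  rw [integral_add
    (integrable_of_continuous (hf.continuous.inner (hg.pderiv i).continuous))
    (integrable_of_continuous ((hf.pderiv i).continuous.inner hg.continuous))] at h
  linarith

end Calculus

/-! ### Smooth fields as elements of `L²`, and the divergence condition. -/

section ToL2

theorem toL2_eq {f : Torus → E3} (hf : Continuous f) : toL2 f = (memLp_of_continuous hf).toLp f :=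
  dif_pos _

theorem coeFn_toL2 {f : Torus → E3} (hf : Continuous f) : toL2 f =ᵐ[volume] f := by
  rw [toL2_eq hf]; exact MemLp.coeFn_toLp _

theorem toL2_add {f g : Torus → E3} (hf : Continuous f) (hg : Continuous g) :
    toL2 (fun x => f x + g x) = toL2 f + toL2 g := by
  rw [toL2_eq hf, toL2_eq hg, toL2_eq (hf.fun_add hg)]; rfl

theorem toL2_sub {f g : Torus → E3} (hf : Continuous f) (hg : Continuous g) :
    toL2 (fun x => f x - g x) = toL2 f - toL2 g := by
  rw [toL2_eq hf, toL2_eq hg, toL2_eq (hf.fun_sub hg)]; rfl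

theorem toL2_smul (c : ℝ) {f : Torus → E3} (hf : Continuous f) :
    toL2 (fun x => c • f x) = c • toL2 f := by
  rw [toL2_eq hf, toL2_eq (hf.fun_const_smul c)]; rfl

theorem toL2_zero : toL2 (fun _ => 0) = 0 := by
  rw [toL2_eq continuous_const]; rfl

theorem inner_toL2_right (u : L2) {f : Torus → E3} (hf : Continuous f) :
    inner ℝ u (toL2 f) = ∫ x, inner ℝ (u x) (f x) := by
  rw [MeasureTheory.L2.inner_def]
  refine integral_congr_ae ?_
  filter_upwards [coeFn_toL2 hf] with x hx
  rw [hx]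

theorem inner_toL2 {f g : Torus → E3} (hf : Continuous f) (hg : Continuous g) :
    inner ℝ (toL2 f) (toL2 g) = ∫ x, inner ℝ (f x) (g x) := by
  rw [inner_toL2_right _ hg]
  refine integral_congr_ae ?_
  filter_upwards [coeFn_toL2 hf] with x hx
  rw [hx]

theorem norm_toL2_sq {f : Torus → E3} (hf : Continuous f) : ‖toL2 f‖ ^ 2 = ∫ x, ‖f x‖ ^ 2 := by
  rw [← real_inner_self_eq_norm_sq, inner_toL2 hf hf]
  simp only [real_inner_self_eq_norm_sq]

theorem hasWeakPDeriv_toL2 {f : Torus → E3} (hf : IsSmooth f) (i : Fin 3) :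
    HasWeakPDeriv i (toL2 f) (toL2 (pderiv i f)) := by
  intro ψ hψ
  rw [inner_toL2 hf.continuous (hψ.pderiv i).continuous,
    inner_toL2 (hf.pderiv i).continuous hψ.continuous, integral_inner_pderiv hf hψ]

theorem grad_isSmooth {q : Torus → ℝ} (hq : IsSmooth q) : IsSmooth (grad q) := by
  unfold IsSmooth
  rw [contDiff_euclidean]
  exact fun i => hq.pderiv i

theorem mem_H0_iff {u : L2} :
    u ∈ H0 ↔ ∀ q : Torus → ℝ, IsSmooth q → inner ℝ u (toL2 (grad q)) = 0 := by
  rw [H0, Submodule.mem_orthogonal']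
  constructor
  · exact fun h q hq => h _ (Submodule.subset_span ⟨q, hq, rfl⟩)
  · intro h v hv
    induction hv using Submodule.span_induction with
    | mem v hv => obtain ⟨q, hq, rfl⟩ := hv; exact h q hq
    | zero => exact inner_zero_right _
    | add x y _ _ hx hy => rw [inner_add_right, hx, hy, add_zero]
    | smul c x _ hx => rw [inner_smul_right, hx, mul_zero]

/-- Integration by parts in each coordinate. This links the pointwise divergence with the
distributional one defining `H0`, and it serves in both directions: for `IsSolenoidal.mem_H0` and
for `div_eq_zero_of_orthogonal`. -/
theorem inner_toL2_grad {ψ : Torus → E3} (hψ : IsSmooth ψ) {q : Torus → ℝ} (hq : IsSmooth q) :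
    inner ℝ (toL2 ψ) (toL2 (grad q)) = -∫ x, (∑ i, pderiv i (fun y => ψ y i) x) * q x := by
  rw [inner_toL2 hψ.continuous (grad_isSmooth hq).continuous]
  have h1 : ∀ x, inner ℝ (ψ x) (grad q x) = ∑ i, ψ x i * pderiv i q x := fun x => by
    simp [PiLp.inner_apply, grad, mul_comm]
  simp only [h1, Finset.sum_mul]
  rw [integral_finsetSum _ fun i _ => integrable_of_continuous
      ((hψ.apply i).continuous.fun_mul (hq.pderiv i).continuous),
    integral_finsetSum _ fun i _ => integrable_of_continuous
      (((hψ.apply i).pderiv i).continuous.fun_mul hq.continuous), ← Finset.sum_neg_distrib]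
  exact Finset.sum_congr rfl fun i _ => integral_mul_pderiv (hψ.apply i) hq i

theorem IsSolenoidal.mem_H0 {ψ : Torus → E3} (hψ : IsSolenoidal ψ) : toL2 ψ ∈ H0 := by
  rw [mem_H0_iff]
  intro q hq
  rw [inner_toL2_grad hψ.smooth hq]
  simp [hψ.div_free]

theorem IsSolenoidal.sub {f g : Torus → E3} (hf : IsSolenoidal f) (hg : IsSolenoidal g) :
    IsSolenoidal (fun x => f x - g x) := by
  refine ⟨hf.smooth.sub hg.smooth, fun x => ?_⟩
  have h : ∀ i, pderiv i (fun y => (f y - g y) i) x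
      = pderiv i (fun y => f y i) x - pderiv i (fun y => g y i) x := fun i =>
    congrFun (pderiv_sub (hf.smooth.apply i) (hg.smooth.apply i) i) x
  simp only [h, Finset.sum_sub_distrib, hf.div_free, hg.div_free, sub_zero]

theorem IsSolenoidal.const (c : E3) : IsSolenoidal (fun _ => c) :=
  ⟨IsSmooth.const c, fun x => by simp [pderiv_const]⟩

end ToL2

/-! ### Trigonometric polynomials and their density. -/

/-- A finite dimensional space of smooth functions on the torus that is invariant under
differentiation. -/
structure IsInvariant (W : Submodule ℝ (Torus → ℝ)) : Prop where
  finite : FiniteDimensional ℝ W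
  smooth : ∀ f ∈ W, IsSmooth f
  pderiv : ∀ f ∈ W, ∀ i, DampedEuler.pderiv i f ∈ W

theorem IsInvariant.sup {W W' : Submodule ℝ (Torus → ℝ)} (h : IsInvariant W)
    (h' : IsInvariant W') : IsInvariant (W ⊔ W') := by
  have := h.finite
  have := h'.finite
  refine ⟨inferInstance, fun f hf => ?_, fun f hf i => ?_⟩
  · obtain ⟨a, ha, b, hb, rfl⟩ := Submodule.mem_sup.1 hf
    exact (h.smooth a ha).add (h'.smooth b hb)
  · obtain ⟨a, ha, b, hb, rfl⟩ := Submodule.mem_sup.1 hf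
    have := pderiv_add (h.smooth a ha) (h'.smooth b hb) i
    exact Submodule.mem_sup.2 ⟨_, h.pderiv a ha i, _, h'.pderiv b hb i, this.symm⟩

theorem pderiv_zero (i : Fin 3) : pderiv i (0 : Torus → ℝ) = 0 := pderiv_const i 0

/-- Stability under differentiation is the Leibniz rule, and the product of finitely generated
submodules is finitely generated. -/
theorem IsInvariant.mul {W W' : Submodule ℝ (Torus → ℝ)} (h : IsInvariant W)
    (h' : IsInvariant W') : IsInvariant (W * W') := by
  have hsmooth : ∀ f ∈ W * W', IsSmooth f := fun f hf => by
    induction hf using Submodule.mul_induction_on' with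
    | mem_mul_mem a ha b hb => exact (h.smooth a ha).mul (h'.smooth b hb)
    | add a _ b _ ha hb => exact ha.add hb
  refine ⟨?_, hsmooth, fun f hf i => ?_⟩
  · exact Module.Finite.iff_fg.2
      ((Module.Finite.iff_fg.1 h.finite).mul (Module.Finite.iff_fg.1 h'.finite))
  · induction hf using Submodule.mul_induction_on' with
    | mem_mul_mem a ha b hb =>
      have := pderiv_mul (h.smooth a ha) (h'.smooth b hb) i
      exact this ▸ Submodule.add_mem _ (Submodule.mul_mem_mul (h.pderiv a ha i) hb)
        (Submodule.mul_mem_mul ha (h'.pderiv b hb i))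
    | add a ha' b hb' ha hb =>
      have := pderiv_add (hsmooth a ha') (hsmooth b hb') i
      exact this ▸ Submodule.add_mem _ ha hb

/-- Membership in some finite dimensional space of smooth functions that is invariant under
differentiation. -/
def IsFiniteType (f : Torus → ℝ) : Prop := ∃ W, IsInvariant W ∧ f ∈ W

theorem IsFiniteType.add {f g : Torus → ℝ} (hf : IsFiniteType f) (hg : IsFiniteType g) :
    IsFiniteType (f + g) := by
  obtain ⟨W, hW, hfW⟩ := hf
  obtain ⟨W', hW', hgW'⟩ := hg
  exact ⟨_, hW.sup hW', Submodule.add_mem_sup hfW hgW'⟩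

theorem IsFiniteType.mul {f g : Torus → ℝ} (hf : IsFiniteType f) (hg : IsFiniteType g) :
    IsFiniteType (f * g) := by
  obtain ⟨W, hW, hfW⟩ := hf
  obtain ⟨W', hW', hgW'⟩ := hg
  exact ⟨_, hW.mul hW', Submodule.mul_mem_mul hfW hgW'⟩

/-- The cosine of a coordinate. -/
noncomputable def cosCoord (j : Fin 3) : Torus → ℝ := fun x => Real.Angle.cos (x j)

/-- The sine of a coordinate. -/
noncomputable def sinCoord (j : Fin 3) : Torus → ℝ := fun x => Real.Angle.sin (x j)

theorem cosCoord_toTorus (j : Fin 3) (y : Fin 3 → ℝ) : cosCoord j (toTorus y) = Real.cos (y j) :=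
  Real.Angle.cos_coe _

theorem sinCoord_toTorus (j : Fin 3) (y : Fin 3 → ℝ) : sinCoord j (toTorus y) = Real.sin (y j) :=
  Real.Angle.sin_coe _

theorem isSmooth_cosCoord (j : Fin 3) : IsSmooth (cosCoord j) := by
  unfold IsSmooth
  simp only [cosCoord_toTorus]
  fun_prop

theorem isSmooth_sinCoord (j : Fin 3) : IsSmooth (sinCoord j) := by
  unfold IsSmooth
  simp only [sinCoord_toTorus]
  fun_prop

theorem hasDerivAt_line_coord (y : Fin 3 → ℝ) (i j : Fin 3) :
    HasDerivAt (fun s : ℝ => (y + s • (Pi.single i 1 : Fin 3 → ℝ)) j)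
      ((Pi.single i 1 : Fin 3 → ℝ) j) 0 := by
  simpa using ((hasDerivAt_id (0 : ℝ)).mul_const ((Pi.single i 1 : Fin 3 → ℝ) j)).const_add (y j)

theorem pderiv_cosCoord (i j : Fin 3) :
    pderiv i (cosCoord j) = (-(Pi.single i 1 : Fin 3 → ℝ) j) • sinCoord j := by
  funext x
  obtain ⟨y, rfl⟩ := toTorus_surjective x
  have h := (hasDerivAt_line_coord y i j).cos
  simp only [pderiv, toTorus_add_single, cosCoord_toTorus]
  rw [h.deriv, Pi.smul_apply, sinCoord_toTorus]
  simp [mul_comm]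

theorem pderiv_sinCoord (i j : Fin 3) :
    pderiv i (sinCoord j) = ((Pi.single i 1 : Fin 3 → ℝ) j) • cosCoord j := by
  funext x
  obtain ⟨y, rfl⟩ := toTorus_surjective x
  have h := (hasDerivAt_line_coord y i j).sin
  simp only [pderiv, toTorus_add_single, sinCoord_toTorus]
  rw [h.deriv, Pi.smul_apply, cosCoord_toTorus]
  simp [mul_comm]

theorem pderiv_const_smul (i : Fin 3) (c : ℝ) {f : Torus → ℝ} (hf : IsSmooth f) :
    pderiv i (c • f) = c • pderiv i f :=
  pderiv_clm (c • ContinuousLinearMap.id ℝ ℝ) hf i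

/-- A finite set of smooth functions whose derivatives lie in its span spans an invariant space. -/
theorem isInvariant_span {s : Set (Torus → ℝ)} (hs : s.Finite) (hsm : ∀ f ∈ s, IsSmooth f)
    (hd : ∀ f ∈ s, ∀ i, pderiv i f ∈ Submodule.span ℝ s) : IsInvariant (Submodule.span ℝ s) := by
  have hsmooth : ∀ f ∈ Submodule.span ℝ s, IsSmooth f := fun f hf => by
    induction hf using Submodule.span_induction with
    | mem f hf => exact hsm f hf
    | zero => exact IsSmooth.const 0
    | add a b _ _ ha hb => exact ha.add hb
    | smul c a _ ha => exact ha.clm (c • ContinuousLinearMap.id ℝ ℝ)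
  refine ⟨FiniteDimensional.span_of_finite ℝ hs, hsmooth, fun f hf i => ?_⟩
  induction hf using Submodule.span_induction with
  | mem f hf => exact hd f hf i
  | zero => rw [pderiv_zero]; exact Submodule.zero_mem _
  | add a b ha' hb' ha hb =>
    have := pderiv_add (hsmooth a ha') (hsmooth b hb') i
    exact this ▸ Submodule.add_mem _ ha hb
  | smul c a ha' ha =>
    rw [pderiv_const_smul i c (hsmooth a ha')]
    exact Submodule.smul_mem _ c ha

/-- Differentiation in the same coordinate exchanges the two generators up to sign; in any other
coordinate it kills them. -/
theorem isInvariant_trig (j : Fin 3) :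
    IsInvariant (Submodule.span ℝ {cosCoord j, sinCoord j}) := by
  refine isInvariant_span (by simp) ?_ ?_
  · rintro f (rfl | rfl)
    exacts [isSmooth_cosCoord j, isSmooth_sinCoord j]
  · rintro f (rfl | rfl) i
    · rw [pderiv_cosCoord]
      exact Submodule.smul_mem _ _ (Submodule.subset_span (by simp))
    · rw [pderiv_sinCoord]
      exact Submodule.smul_mem _ _ (Submodule.subset_span (by simp))

theorem isFiniteType_const (c : ℝ) : IsFiniteType (fun _ => c) := by
  refine ⟨Submodule.span ℝ {fun _ => c}, isInvariant_span (by simp) ?_ ?_,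
    Submodule.subset_span rfl⟩
  · rintro f rfl
    exact IsSmooth.const c
  · rintro f rfl i
    rw [pderiv_const]
    exact Submodule.zero_mem _

/-- The algebra of trigonometric polynomials. -/
noncomputable def trigAlgebra : Subalgebra ℝ C(Torus, ℝ) :=
  Algebra.adjoin ℝ (range (fun j => (⟨cosCoord j, (isSmooth_cosCoord j).continuous⟩ : C(Torus, ℝ)))
    ∪ range (fun j => (⟨sinCoord j, (isSmooth_sinCoord j).continuous⟩ : C(Torus, ℝ))))

/-- The generators are of finite type, and this property survives sums and products. It is all that
is needed of trigonometric polynomials: no Fourier coefficients appear. -/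
theorem isFiniteType_of_mem_trigAlgebra {f : C(Torus, ℝ)} (hf : f ∈ trigAlgebra) :
    IsFiniteType f := by
  unfold trigAlgebra at hf
  induction hf using Algebra.adjoin_induction with
  | mem f hf =>
    rcases hf with ⟨j, rfl⟩ | ⟨j, rfl⟩
    · exact ⟨_, isInvariant_trig j, Submodule.subset_span (by simp)⟩
    · exact ⟨_, isInvariant_trig j, Submodule.subset_span (by simp)⟩
  | algebraMap r => exact isFiniteType_const r
  | add a b _ _ ha hb => exact ha.add hb
  | mul a b _ _ ha hb => exact ha.mul hb

/-- Stone–Weierstrass: the cosine and the sine together determine an angle, so the generators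
separate points. -/
theorem trigAlgebra_dense : Dense (trigAlgebra : Set C(Torus, ℝ)) := by
  have h := ContinuousMap.subalgebra_topologicalClosure_eq_top_of_separatesPoints trigAlgebra ?_
  · intro f
    have : f ∈ trigAlgebra.topologicalClosure := h ▸ Algebra.mem_top
    exact this
  · intro x y hxy
    by_contra! hcon
    refine hxy (funext fun j => ?_)
    have hc : cosCoord j x = cosCoord j y :=
      hcon _ ⟨_, Algebra.subset_adjoin (Or.inl ⟨j, rfl⟩), rfl⟩
    have hs : sinCoord j x = sinCoord j y :=
      hcon _ ⟨_, Algebra.subset_adjoin (Or.inr ⟨j, rfl⟩), rfl⟩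
    obtain ⟨a, rfl⟩ := toTorus_surjective x
    obtain ⟨b, rfl⟩ := toTorus_surjective y
    rw [cosCoord_toTorus, cosCoord_toTorus] at hc
    rw [sinCoord_toTorus, sinCoord_toTorus] at hs
    exact Real.Angle.cos_sin_inj hc hs

theorem toLp_eq_toL2 (f : C(Torus, E3)) : ContinuousMap.toLp 2 volume ℝ f = toL2 f := by
  refine Lp.ext ?_
  filter_upwards [ContinuousMap.coeFn_toLp (p := 2) (𝕜 := ℝ) (volume : Measure Torus) f,
    coeFn_toL2 f.continuous] with x h1 h2
  rw [h1, h2]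

/-- The vector field with the given components. -/
def field (w : Fin 3 → Torus → ℝ) : Torus → E3 := fun x => WithLp.toLp 2 (fun j => w j x)

theorem IsSmooth.field {w : Fin 3 → Torus → ℝ} (hw : ∀ j, IsSmooth (w j)) :
    IsSmooth (DampedEuler.field w) := by
  unfold IsSmooth
  rw [contDiff_euclidean]
  exact hw

theorem pderiv_field {w : Fin 3 → Torus → ℝ} (hw : ∀ j, IsSmooth (w j)) (i : Fin 3) :
    pderiv i (field w) = field (fun j => pderiv i (w j)) := by
  funext x
  ext j
  exact (congrFun (pderiv_apply (IsSmooth.field hw) i j) x).symm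

/-- Fields whose components are of finite type are dense in `L²`. -/
theorem exists_finiteType_near (u : L2) {ε : ℝ} (hε : 0 < ε) :
    ∃ w : Fin 3 → Torus → ℝ, (∀ j, IsFiniteType (w j)) ∧ ‖u - toL2 (field w)‖ < ε := by
  let e : Fin 3 → ℝ →L[ℝ] E3 := fun j =>
    ContinuousLinearMap.toSpanSingleton ℝ (EuclideanSpace.single j (1 : ℝ))
  let T : (Fin 3 → C(Torus, ℝ)) → L2 := fun c =>
    ContinuousMap.toLp 2 volume ℝ (∑ j, (e j).compLeftContinuous ℝ Torus (c j))
  have hsum : ∀ c : Fin 3 → C(Torus, ℝ),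
      ((∑ j, (e j).compLeftContinuous ℝ Torus (c j) : C(Torus, E3)) : Torus → E3)
        = field (fun j => c j) := fun c => by
    funext x
    ext k
    simp [e, field, ContinuousMap.sum_apply, Finset.sum_apply, Pi.single_apply]
  have hT : Continuous T := (ContinuousLinearMap.continuous _).comp
    (continuous_finsetSum _ fun j _ => (ContinuousMap.continuous_postcomp
      (⟨e j, (e j).continuous⟩ : C(ℝ, E3))).comp (continuous_apply j))
  have hrange : DenseRange T := by
    have h1 := ContinuousMap.toLp_denseRange E3 (volume : Measure Torus) (p := 2) ℝ (by simp)
    refine h1.mono ?_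
    rintro _ ⟨g, rfl⟩
    refine ⟨fun j => ⟨fun x => g x j, by fun_prop⟩, ?_⟩
    simp only [T]
    congr 1
    refine ContinuousMap.ext fun x => ?_
    rw [hsum]
    rfl
  -- Components range over a dense subset of `C(𝕋)³`, and `T` is continuous with dense range, so the
  -- image of that subset is dense in `L²`.
  have hd : Dense (T '' {c | ∀ j ∈ (univ : Set (Fin 3)), c j ∈ (trigAlgebra : Set C(Torus, ℝ))}) :=
    hrange.dense_image hT (dense_pi univ fun j _ => trigAlgebra_dense)
  obtain ⟨_, ⟨c, hc, rfl⟩, hlt⟩ := Metric.dense_iff.1 hd u ε hε |>.imp fun _ h => h.symm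
  refine ⟨fun j => c j, fun j => isFiniteType_of_mem_trigAlgebra (hc j (mem_univ j)), ?_⟩
  rw [← hsum, ← toLp_eq_toL2, ← dist_eq_norm, dist_comm]
  exact hlt

/-! ### Approximation of divergence free `H¹` fields by projection. -/

theorem exists_isInvariant_of_isFiniteType {ι : Type} (s : Finset ι) {f : ι → Torus → ℝ}
    (hf : ∀ i, IsFiniteType (f i)) : ∃ W, IsInvariant W ∧ ∀ i ∈ s, f i ∈ W := by
  classical
  induction s using Finset.induction_on with
  | empty =>
    obtain ⟨W, hW, -⟩ := isFiniteType_const 0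
    exact ⟨W, hW, by simp⟩
  | insert a s _ ih =>
    obtain ⟨W, hW, h⟩ := ih
    obtain ⟨W', hW', h'⟩ := hf a
    refine ⟨_, hW.sup hW', fun i hi => ?_⟩
    rcases Finset.mem_insert.1 hi with rfl | hi
    · exact Submodule.mem_sup_right h'
    · exact Submodule.mem_sup_left (h i hi)

/-- The space of classes of vector fields with components in `W`. -/
noncomputable def fieldSpace {W : Submodule ℝ (Torus → ℝ)} (hW : IsInvariant W) :
    Submodule ℝ L2 :=
  LinearMap.range ({
    toFun := fun w : Fin 3 → W => toL2 (field fun j => w j)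
    map_add' := fun a b => toL2_add
      (IsSmooth.field fun j => hW.smooth _ (a j).2).continuous
      (IsSmooth.field fun j => hW.smooth _ (b j).2).continuous
    map_smul' := fun c a => toL2_smul c
      (IsSmooth.field fun j => hW.smooth _ (a j).2).continuous } : (Fin 3 → W) →ₗ[ℝ] L2)

theorem mem_fieldSpace {W : Submodule ℝ (Torus → ℝ)} (hW : IsInvariant W) {v : L2} :
    v ∈ fieldSpace hW ↔ ∃ w : Fin 3 → Torus → ℝ, (∀ j, w j ∈ W) ∧ v = toL2 (field w) := by
  constructor
  · rintro ⟨w, rfl⟩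
    exact ⟨fun j => w j, fun j => (w j).2, rfl⟩
  · rintro ⟨w, hw, rfl⟩
    exact ⟨fun j => ⟨w j, hw j⟩, rfl⟩

theorem finiteDimensional_fieldSpace {W : Submodule ℝ (Torus → ℝ)} (hW : IsInvariant W) :
    FiniteDimensional ℝ (fieldSpace hW) := by
  have := hW.finite
  unfold fieldSpace
  infer_instance

/-- Testing with the gradient of the divergence itself gives `∫ (div w)² = 0`, and continuity turns
vanishing almost everywhere into vanishing everywhere. A single orthogonality relation suffices;
when the components lie in an invariant space, so does this test function. -/
theorem div_eq_zero_of_orthogonal {w : Fin 3 → Torus → ℝ} (hw : ∀ j, IsSmooth (w j))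
    (h : inner ℝ (toL2 (field w)) (toL2 (grad fun x => ∑ i, pderiv i (w i) x)) = 0) :
    IsSolenoidal (field w) := by
  have hs : IsSmooth (fun x => ∑ i, pderiv i (w i) x) := IsSmooth.sum fun i _ => (hw i).pderiv i
  refine ⟨IsSmooth.field hw, ?_⟩
  rw [inner_toL2_grad (IsSmooth.field hw) hs, neg_eq_zero] at h
  have h2 := (integral_eq_zero_iff_of_nonneg (fun x => mul_self_nonneg _)
    (integrable_of_continuous (hs.continuous.fun_mul hs.continuous))).1 h
  have h3 := (Continuous.ae_eq_iff_eq (volume : Measure Torus)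
    (hs.continuous.fun_mul hs.continuous) continuous_const).1 h2
  exact fun x => mul_self_eq_zero.1 (congrFun h3 x)

/-- Fields of class `H¹` are limits of smooth fields in the norm of `H¹`, and the approximations are
divergence free if the field is. -/
theorem exists_solenoidal_near {u : L2} (hu : u ∈ H0) {v : Fin 3 → L2}
    (hv : ∀ i, HasWeakPDeriv i u (v i)) {ε : ℝ} (hε : 0 < ε) :
    ∃ ψ, IsSolenoidal ψ ∧ ‖u - toL2 ψ‖ < ε ∧ ∀ i, ‖v i - toL2 (pderiv i ψ)‖ < ε := by
  -- The field and its three weak derivatives form one family, so that a single invariant space `W`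
  -- approximates all four.
  let U : Option (Fin 3) → L2 := fun k => k.elim u v
  choose a ha ha' using fun k => exists_finiteType_near (U k) hε
  obtain ⟨W, hW, haW⟩ := exists_isInvariant_of_isFiniteType
    (Finset.univ : Finset (Option (Fin 3) × Fin 3)) (f := fun p => a p.1 p.2)
    (fun p => ha p.1 p.2)
  have := finiteDimensional_fieldSpace hW
  set V := fieldSpace hW with hV
  have hnear : ∀ k, ‖U k - V.starProjection (U k)‖ < ε := fun k => by
    refine lt_of_le_of_lt ?_ (ha' k)
    -- The projection is at least as close as the approximant `a k`, which lies in `V`.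
    rw [V.starProjection_minimal]
    exact ciInf_le ⟨0, by rintro _ ⟨x, rfl⟩; exact norm_nonneg _⟩
      (⟨toL2 (field (a k)), (mem_fieldSpace hW).2
        ⟨a k, fun j => haW (k, j) (Finset.mem_univ _), rfl⟩⟩ : V)
  obtain ⟨w, hwW, hw⟩ := (mem_fieldSpace hW).1 (V.starProjection_apply_mem u)
  have hws : ∀ j, IsSmooth (w j) := fun j => hW.smooth _ (hwW j)
  have horth : ∀ z ∈ V, inner ℝ u z = inner ℝ (toL2 (field w)) z := fun z hz => by
    have := V.starProjection_inner_eq_zero u z hz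
    rw [inner_sub_left, hw] at this
    linarith
  refine ⟨field w, div_eq_zero_of_orthogonal hws ?_, ?_, fun i => ?_⟩
  -- The divergence of the projected field is in `W`, so its gradient is in `V`. There the
  -- projection of `u` pairs as `u` does, and `u` annihilates gradients.
  · have hq : (fun x => ∑ i, pderiv i (w i) x) ∈ W := by
      have : (fun x => ∑ i, pderiv i (w i) x) = ∑ i, pderiv i (w i) := by
        funext x; simp
      rw [this]
      exact Submodule.sum_mem _ fun i _ => hW.pderiv _ (hwW i) i
    have hg : toL2 (grad fun x => ∑ i, pderiv i (w i) x) ∈ V :=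
      (mem_fieldSpace hW).2 ⟨_, fun j => hW.pderiv _ hq j, rfl⟩
    rw [← horth _ hg]
    exact mem_H0_iff.1 hu _ (hW.smooth _ hq)
  · rw [← hw]; exact hnear none
  -- The projection `P` commutes with `∂ᵢ`: for `z ∈ V` also `∂ᵢz ∈ V`, hence `(∂ᵢPu, z) = -(Pu,
  -- ∂ᵢz) = -(u, ∂ᵢz) = (vᵢ, z)`.
  · have h : V.starProjection (v i) = toL2 (pderiv i (field w)) := by
      refine Submodule.eq_starProjection_of_mem_orthogonal ?_ ?_
      · rw [pderiv_field hws]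
        exact (mem_fieldSpace hW).2 ⟨_, fun j => hW.pderiv _ (hwW j) i, rfl⟩
      · rw [Submodule.mem_orthogonal']
        intro z hz
        obtain ⟨b, hb, rfl⟩ := (mem_fieldSpace hW).1 hz
        have hbs : ∀ j, IsSmooth (b j) := fun j => hW.smooth _ (hb j)
        have h1 := hv i (field b) (IsSmooth.field hbs)
        have h2 := hasWeakPDeriv_toL2 (IsSmooth.field hws) i (field b) (IsSmooth.field hbs)
        have h3 := horth (toL2 (pderiv i (field b))) (by
          rw [pderiv_field hbs]
          exact (mem_fieldSpace hW).2 ⟨_, fun j => hW.pderiv _ (hb j) i, rfl⟩)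
        rw [inner_sub_left]
        linarith
    rw [← h]; exact hnear (some i)

/-! ### Uniqueness of weak derivatives. -/

theorem eq_zero_of_inner_smooth {d : L2} (h : ∀ ψ, IsSmooth ψ → inner ℝ d (toL2 ψ) = 0) :
    d = 0 := by
  rw [← norm_le_zero_iff]
  refine le_of_forall_pos_lt_add fun ε hε => ?_
  obtain ⟨w, hw, hlt⟩ := exists_finiteType_near d hε
  have hs : IsSmooth (field w) := IsSmooth.field fun j => by
    obtain ⟨W, hW, hj⟩ := hw j
    exact hW.smooth _ hj
  rw [zero_add]
  by_contra! hcon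
  have h1 : ‖d‖ ^ 2 = inner ℝ d (d - toL2 (field w)) := by
    rw [inner_sub_right, h _ hs, real_inner_self_eq_norm_sq, sub_zero]
  have h2 := real_inner_le_norm d (d - toL2 (field w))
  nlinarith [norm_nonneg (d - toL2 (field w))]

/-- Smooth fields are dense in `L²`. As `wderiv` is picked by choice, only uniqueness makes it
computable. -/
theorem HasWeakPDeriv.unique {i : Fin 3} {u v v' : L2} (h : HasWeakPDeriv i u v)
    (h' : HasWeakPDeriv i u v') : v = v' := by
  refine sub_eq_zero.1 (eq_zero_of_inner_smooth fun ψ hψ => ?_)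
  rw [inner_sub_left]
  linarith [h ψ hψ, h' ψ hψ]

theorem HasWeakPDeriv.wderiv_eq {i : Fin 3} {u v : L2} (h : HasWeakPDeriv i u v) :
    wderiv i u = v := by
  have hex : ∃ v, HasWeakPDeriv i u v := ⟨v, h⟩
  rw [wderiv, dif_pos hex]
  exact hex.choose_spec.unique h

theorem hasWeakPDeriv_wderiv {i : Fin 3} {u : L2} (h : ∃ v, HasWeakPDeriv i u v) :
    HasWeakPDeriv i u (wderiv i u) := by
  obtain ⟨v, hv⟩ := h
  rwa [hv.wderiv_eq]

theorem HasWeakPDeriv.sub {i : Fin 3} {u u' v v' : L2} (h : HasWeakPDeriv i u v)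
    (h' : HasWeakPDeriv i u' v') : HasWeakPDeriv i (u - u') (v - v') := fun ψ hψ => by
  rw [inner_sub_left, inner_sub_left, h ψ hψ, h' ψ hψ]
  ring

/-! ### Sobolev inequalities on the torus. -/

/-- Average `|h 0| ≤ |h s| + ∫ |h'|` over `s ∈ [0, L]`; the condition `1 ≤ L` allows the factor
`1/L` in front of `∫ |h|` to be dropped. -/
theorem abs_le_intervalIntegral_of_hasDerivAt {h h' : ℝ → ℝ} (hd : ∀ s, HasDerivAt h (h' s) s)
    (hc : Continuous h') {L : ℝ} (hL : 1 ≤ L) :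
    |h 0| ≤ ∫ s in (0 : ℝ)..L, (|h s| + |h' s|) := by
  have hL0 : 0 ≤ L := by linarith
  have hch : Continuous h := continuous_iff_continuousAt.2 fun s => (hd s).continuousAt
  have hi : ∀ a b, IntervalIntegrable (fun s => |h s|) volume a b :=
    fun a b => hch.abs.intervalIntegrable a b
  have hi' : ∀ a b, IntervalIntegrable (fun s => |h' s|) volume a b :=
    fun a b => hc.abs.intervalIntegrable a b
  set J := ∫ s in (0 : ℝ)..L, |h' s| with hJ
  have h1 : ∀ s ∈ Icc 0 L, |h 0| ≤ |h s| + J := fun s hs => by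
    have h2 : ∫ r in (0 : ℝ)..s, h' r = h s - h 0 :=
      intervalIntegral.integral_eq_sub_of_hasDerivAt (fun x _ => hd x) (hc.intervalIntegrable _ _)
    have h3 : |∫ r in (0 : ℝ)..s, h' r| ≤ ∫ r in (0 : ℝ)..s, |h' r| :=
      intervalIntegral.abs_integral_le_integral_abs hs.1
    have h4 : ∫ r in (0 : ℝ)..s, |h' r| ≤ J :=
      intervalIntegral.integral_mono_interval le_rfl hs.1 hs.2
        (Eventually.of_forall fun _ => abs_nonneg _) (hi' _ _)
    rw [h2] at h3
    have h5 : |h 0| ≤ |h s| + |h s - h 0| := by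
      have := abs_sub_abs_le_abs_sub (h 0) (h s)
      rw [abs_sub_comm] at this
      linarith
    linarith
  have h6 : ∫ _ in (0 : ℝ)..L, |h 0| ≤ ∫ s in (0 : ℝ)..L, (|h s| + J) :=
    intervalIntegral.integral_mono_on hL0 (by simp)
      ((hi 0 L).add (by simp)) h1
  rw [intervalIntegral.integral_add (hi 0 L) (by simp)] at h6
  simp only [intervalIntegral.integral_const, smul_eq_mul, sub_zero] at h6
  rw [intervalIntegral.integral_add (hi 0 L) (hi' 0 L)]
  have h7 : 0 ≤ ∫ s in (0 : ℝ)..L, |h s| :=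
    intervalIntegral.integral_nonneg hL0 fun _ _ => abs_nonneg _
  have h8 : (|h 0| - J) * L ≤ ∫ s in (0 : ℝ)..L, |h s| := by linarith
  by_contra! hcon
  nlinarith

theorem add_single_eq_update (x : Torus) (i : Fin 3) (s : AddCircle (2 * Real.pi)) :
    x + Pi.single i s = Function.update x i (x i + s) := by
  funext j
  by_cases h : j = i
  · subst h; simp
  · simp [h]

/-- A smooth function on the torus is bounded by integrals over coordinate circles. -/
theorem IsSmooth.abs_le_integral_update {w : Torus → ℝ} (hw : IsSmooth w) (x : Torus)
    (i : Fin 3) : |w x| ≤ ∫ ξ, (|w (Function.update x i ξ)|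
      + |DampedEuler.pderiv i w (Function.update x i ξ)|) := by
  have hcont : Continuous fun s : ℝ => x + Pi.single i (s : AddCircle (2 * Real.pi)) :=
    continuous_const.add ((continuous_single i).comp (AddCircle.continuous_mk' _))
  have h := abs_le_intervalIntegral_of_hasDerivAt
    (h := fun s : ℝ => w (x + Pi.single i (s : AddCircle (2 * Real.pi))))
    (h' := fun s : ℝ => DampedEuler.pderiv i w (x + Pi.single i (s : AddCircle (2 * Real.pi))))
    (fun s => hw.hasDerivAt_line i x s) ((hw.pderiv i).continuous.comp hcont)
    (L := 2 * Real.pi) (by linarith [Real.pi_gt_three])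
  have h2 := AddCircle.intervalIntegral_preimage (2 * Real.pi) 0
    (fun ξ => |w (x + Pi.single i ξ)| + |DampedEuler.pderiv i w (x + Pi.single i ξ)|)
  rw [zero_add] at h2
  rw [h2] at h
  simp only [add_single_eq_update] at h
  -- Translation invariance on the circle removes the offset `x i`.
  have h3 := integral_add_left_eq_self (μ := (volume : Measure (AddCircle (2 * Real.pi))))
    (fun ξ => |w (Function.update x i ξ)| + |DampedEuler.pderiv i w (Function.update x i ξ)|) (x i)
  rw [h3] at h
  simpa using h

/-- The Gagliardo–Nirenberg argument in dimension 3. Bound each of the three factors of `v³` by the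
square root of the integral of `k` along one coordinate circle, and integrate the product by the
grid inequality. Its exponents are `1/(3 - 1) = 1/2` on the line integrals and the conjugate
exponent `3/2` on the total integral. -/
theorem integral_cube_sq_le {v k : Torus → ℝ} (hv : Continuous v) (hk : Continuous k)
    (hk0 : ∀ x, 0 ≤ k x) (hv0 : ∀ x, 0 ≤ v x)
    (h : ∀ x i, v x ^ 2 ≤ ∫ ξ, k (Function.update x i ξ)) :
    (∫ x, v x ^ 3) ^ 2 ≤ (∫ x, k x) ^ 3 := by
  have hconj : ((Fintype.card (Fin 3) : ℕ) : ℝ).HolderConjugate (3 / 2) := by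
    rw [Real.holderConjugate_iff]
    norm_num
  have hgrid := lintegral_prod_lintegral_pow_le
    (fun _ : Fin 3 => (volume : Measure (AddCircle (2 * Real.pi)))) hconj
    (f := fun x => ENNReal.ofReal (k x)) (ENNReal.measurable_ofReal.comp hk.measurable)
  have hslice : ∀ (x : Torus) (i : Fin 3), Continuous fun ξ => k (Function.update x i ξ) :=
    fun x i => hk.comp (continuous_const.update i continuous_id)
  have hpt : ∀ x : Torus, ENNReal.ofReal (v x ^ 3) ≤
      ∏ i : Fin 3, (∫⁻ ξ, ENNReal.ofReal (k (Function.update x i ξ)))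
        ^ ((1 : ℝ) / (((Fintype.card (Fin 3) : ℕ) : ℝ) - 1)) := fun x => by
    have h1 : ∀ i : Fin 3, ENNReal.ofReal (v x) ≤
        (∫⁻ ξ, ENNReal.ofReal (k (Function.update x i ξ)))
          ^ ((1 : ℝ) / (((Fintype.card (Fin 3) : ℕ) : ℝ) - 1)) := fun i => by
      rw [← ofReal_integral_eq_lintegral_ofReal
        ((hslice x i).integrable_of_hasCompactSupport (HasCompactSupport.of_compactSpace _))
        (Eventually.of_forall fun _ => hk0 _), ENNReal.ofReal_rpow_of_nonneg
          (integral_nonneg fun _ => hk0 _) (by norm_num)]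
      refine ENNReal.ofReal_le_ofReal ?_
      have : (1 : ℝ) / (((Fintype.card (Fin 3) : ℕ) : ℝ) - 1) = 1 / 2 := by norm_num
      rw [this, ← Real.sqrt_eq_rpow]
      exact Real.le_sqrt_of_sq_le (h x i)
    rw [ENNReal.ofReal_pow (hv0 x)]
    calc ENNReal.ofReal (v x) ^ 3 = ∏ _i : Fin 3, ENNReal.ofReal (v x) := by simp
      _ ≤ _ := Finset.prod_le_prod' fun i _ => h1 i
  have h2 : ENNReal.ofReal (∫ x, v x ^ 3) ≤ ENNReal.ofReal ((∫ x, k x) ^ (3 / 2 : ℝ)) := by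
    rw [ofReal_integral_eq_lintegral_ofReal (integrable_of_continuous (f := fun x => v x ^ 3) (by fun_prop))
      (Eventually.of_forall fun x => pow_nonneg (hv0 x) 3),
      ← ENNReal.ofReal_rpow_of_nonneg (integral_nonneg hk0) (by norm_num),
      ofReal_integral_eq_lintegral_ofReal (integrable_of_continuous hk)
      (Eventually.of_forall hk0)]
    exact (lintegral_mono hpt).trans hgrid
  have hK : 0 ≤ ∫ x, k x := integral_nonneg hk0
  have h3 := (ENNReal.ofReal_le_ofReal_iff (Real.rpow_nonneg hK _)).1 h2
  have h4 : 0 ≤ ∫ x, v x ^ 3 := integral_nonneg fun x => pow_nonneg (hv0 x) 3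
  calc (∫ x, v x ^ 3) ^ 2 ≤ ((∫ x, k x) ^ (3 / 2 : ℝ)) ^ 2 := pow_le_pow_left₀ h4 h3 2
    _ = (∫ x, k x) ^ 3 := by
      rw [← Real.rpow_natCast, ← Real.rpow_mul hK, ← Real.rpow_natCast]
      norm_num

/-- The quadratic polynomial `t ↦ ∫ (t a + b)²` is nonnegative, so its discriminant is not positive.
-/
theorem integral_mul_sq_le {a b : Torus → ℝ} (ha : Continuous a) (hb : Continuous b) :
    (∫ x, a x * b x) ^ 2 ≤ (∫ x, a x ^ 2) * ∫ x, b x ^ 2 := by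
  have h : ∀ t : ℝ, 0 ≤ (∫ x, a x ^ 2) * (t * t) + (2 * ∫ x, a x * b x) * t + ∫ x, b x ^ 2 := by
    intro t
    have h1 : (∫ x, a x ^ 2) * (t * t) + (2 * ∫ x, a x * b x) * t + ∫ x, b x ^ 2
        = ∫ x, (t * a x + b x) ^ 2 := by
      have : ∀ x, (t * a x + b x) ^ 2 = (t * t) * a x ^ 2 + (2 * t) * (a x * b x) + b x ^ 2 :=
        fun x => by ring
      simp only [this]
      rw [integral_add (integrable_of_continuous (by fun_prop))
        (integrable_of_continuous (by fun_prop)), integral_add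
        (integrable_of_continuous (by fun_prop)) (integrable_of_continuous (by fun_prop)),
        integral_const_mul, integral_const_mul]
      ring
    rw [h1]
    exact integral_nonneg fun x => sq_nonneg _
  have := discrim_le_zero h
  rw [discrim] at this
  linarith

theorem pderiv_pow_four {f : Torus → ℝ} (hf : IsSmooth f) (i : Fin 3) :
    pderiv i (fun x => f x ^ 4) = fun x => 4 * f x ^ 3 * pderiv i f x :=
  funext fun x => by
    refine ((hf.hasDerivAt_pderiv i x).fun_pow 4).deriv.trans ?_
    simp

/-- The square of the `H¹` norm of a smooth scalar function. -/
noncomputable def scalarH1 (f : Torus → ℝ) : ℝ :=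
  (∫ x, f x ^ 2) + ∑ i, ∫ x, pderiv i f x ^ 2

theorem scalarH1_nonneg (f : Torus → ℝ) : 0 ≤ scalarH1 f :=
  add_nonneg (integral_nonneg fun _ => sq_nonneg _)
    (Finset.sum_nonneg fun _ _ => integral_nonneg fun _ => sq_nonneg _)

/-- The Sobolev inequality for the exponent `6`. -/
theorem integral_pow_six_le {f : Torus → ℝ} (hf : IsSmooth f) :
    ∫ x, f x ^ 6 ≤ (49 * scalarH1 f) ^ 3 := by
  have hc := hf.continuous
  have hcd : ∀ i, Continuous (pderiv i f) := fun i => (hf.pderiv i).continuous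
  -- Since `∂ᵢ(f⁴) = 4 f³ ∂ᵢf`, the function `|f|³ b` dominates `|f⁴| + |∂ᵢ(f⁴)|` for every `i`; one
  -- `k` thus serves all three directions in `integral_cube_sq_le`, applied to `v = f²`.
  set b : Torus → ℝ := fun x => |f x| + 4 * ∑ i, |pderiv i f x| with hb
  have hbc : Continuous b := by fun_prop
  have hb0 : ∀ x, 0 ≤ b x := fun x => by positivity
  have hpow : IsSmooth (fun x => f x ^ 4) := ContDiff.pow hf 4
  have h1 := integral_cube_sq_le (v := fun x => f x ^ 2) (k := fun x => |f x| ^ 3 * b x)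
    (by fun_prop) (by fun_prop) (fun x => mul_nonneg (by positivity) (hb0 x))
    (fun x => sq_nonneg _) (fun x i => by
      have h := hpow.abs_le_integral_update x i
      have hs : Continuous fun ξ : AddCircle (2 * Real.pi) => Function.update x i ξ :=
        continuous_const.update i continuous_id
      have hint : ∀ {k : Torus → ℝ}, Continuous k →
          Integrable (fun ξ : AddCircle (2 * Real.pi) => k (Function.update x i ξ)) volume :=
        fun hk => (hk.comp hs).integrable_of_hasCompactSupport (HasCompactSupport.of_compactSpace _)
      have e1 : (f x ^ 2) ^ 2 = |f x ^ 4| := by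
        rw [abs_of_nonneg (by positivity)]; ring
      rw [e1]
      refine h.trans (integral_mono (hint (k := fun y => |f y ^ 4| + |pderiv i (fun x => f x ^ 4) y|)
        (by
          have := (hpow.pderiv i).continuous
          fun_prop)) (hint (k := fun y => |f y| ^ 3 * b y) (by fun_prop)) fun ξ => ?_)
      simp only [pderiv_pow_four hf]
      generalize Function.update x i ξ = y
      have h5 : |pderiv i f y| ≤ ∑ i, |pderiv i f y| :=
        Finset.single_le_sum (f := fun i => |pderiv i f y|) (fun _ _ => abs_nonneg _)
          (Finset.mem_univ i)
      rw [abs_mul, abs_mul, abs_pow, abs_pow, abs_of_pos (by norm_num : (0 : ℝ) < 4)]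
      have h6 : 0 ≤ |f y| ^ 3 := by positivity
      simp only [hb]
      nlinarith [mul_le_mul_of_nonneg_left h5 h6])
  have h2 := integral_mul_sq_le (a := fun x => |f x| ^ 3) (b := b) (by fun_prop) hbc
  have e2 : ∀ x, (|f x| ^ 3) ^ 2 = f x ^ 6 := fun x => by
    rw [← pow_mul, Even.pow_abs (by decide)]
  have e3 : ∀ x, (f x ^ 2) ^ 3 = f x ^ 6 := fun x => by ring
  simp only [e2] at h2
  simp only [e3] at h1
  -- Cauchy–Schwarz with weights `1, 4, 4, 4`: the constant is `1 + 3 · 16`.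
  have h3 : ∫ x, b x ^ 2 ≤ 49 * scalarH1 f := by
    have : 49 * scalarH1 f = ∫ x, 49 * (f x ^ 2 + ∑ i, pderiv i f x ^ 2) := by
      rw [integral_const_mul, integral_add (integrable_of_continuous (by fun_prop))
        (integrable_of_continuous (by fun_prop)), integral_finsetSum _ fun i _ =>
        integrable_of_continuous (by fun_prop)]
      rfl
    rw [this]
    refine integral_mono (integrable_of_continuous (by fun_prop))
      (integrable_of_continuous (by fun_prop)) fun x => ?_
    simp only [hb, Fin.sum_univ_three]
    rw [← sq_abs (f x), ← sq_abs (pderiv 0 f x), ← sq_abs (pderiv 1 f x), ← sq_abs (pderiv 2 f x)]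
    nlinarith [sq_nonneg (4 * |f x| - |pderiv 0 f x|), sq_nonneg (4 * |f x| - |pderiv 1 f x|),
      sq_nonneg (4 * |f x| - |pderiv 2 f x|), sq_nonneg (|pderiv 0 f x| - |pderiv 1 f x|),
      sq_nonneg (|pderiv 0 f x| - |pderiv 2 f x|), sq_nonneg (|pderiv 1 f x| - |pderiv 2 f x|)]
  have hX : 0 ≤ ∫ x, f x ^ 6 := integral_nonneg fun x => by positivity
  set X := ∫ x, f x ^ 6
  set K := ∫ x, |f x| ^ 3 * b x
  set A := 49 * scalarH1 f
  have hA : 0 ≤ A := mul_nonneg (by norm_num) (scalarH1_nonneg f)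
  have h4 : K ^ 2 ≤ X * A := h2.trans (mul_le_mul_of_nonneg_left h3 hX)
  -- The grid inequality gives `X² ≤ K³` and Cauchy–Schwarz gives `K² ≤ X A`. Eliminating `K` leaves
  -- `X⁴ ≤ X³ A³`, and `X³` cancels unless `X = 0`.
  have h5 : X ^ 4 ≤ (X * A) ^ 3 := by
    calc X ^ 4 = (X ^ 2) ^ 2 := by ring
      _ ≤ (K ^ 3) ^ 2 := pow_le_pow_left₀ (sq_nonneg _) h1 2
      _ = (K ^ 2) ^ 3 := by ring
      _ ≤ (X * A) ^ 3 := pow_le_pow_left₀ (sq_nonneg _) h4 3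
  rcases hX.eq_or_lt with h0 | h0
  · rw [← h0]; positivity
  · have : X ^ 3 * X ≤ X ^ 3 * A ^ 3 := by
      calc X ^ 3 * X = X ^ 4 := by ring
        _ ≤ (X * A) ^ 3 := h5
        _ = X ^ 3 * A ^ 3 := by ring
    exact le_of_mul_le_mul_left this (by positivity)

/-- The Sobolev inequality for the exponent `4`. -/
theorem integral_pow_four_le {f : Torus → ℝ} (hf : IsSmooth f) :
    ∫ x, f x ^ 4 ≤ 343 * scalarH1 f ^ 2 := by
  have hc := hf.continuous
  -- Interpolation between the exponents 2 and 6; the constant arises as `343² = 49³`.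
  have h := integral_mul_sq_le (a := f) (b := fun x => f x ^ 3) hc (by fun_prop)
  have e1 : ∀ x, f x * f x ^ 3 = f x ^ 4 := fun x => by ring
  have e2 : ∀ x, (f x ^ 3) ^ 2 = f x ^ 6 := fun x => by ring
  simp only [e1, e2] at h
  have hA := scalarH1_nonneg f
  have h2 : ∫ x, f x ^ 2 ≤ scalarH1 f :=
    le_add_of_nonneg_right (Finset.sum_nonneg fun _ _ => integral_nonneg fun _ => sq_nonneg _)
  have h3 := h.trans (mul_le_mul h2 (integral_pow_six_le hf)
    (integral_nonneg fun x => by positivity) hA)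
  refine abs_le_of_sq_le_sq' ?_ (by positivity) |>.2
  calc _ ≤ _ := h3
    _ = (343 * scalarH1 f ^ 2) ^ 2 := by ring

/-- The square of the `H¹` norm of a smooth vector field. -/
noncomputable def vectorH1 (ψ : Torus → E3) : ℝ :=
  ‖toL2 ψ‖ ^ 2 + ∑ i, ‖toL2 (pderiv i ψ)‖ ^ 2

theorem vectorH1_nonneg (ψ : Torus → E3) : 0 ≤ vectorH1 ψ := by
  unfold vectorH1; positivity

theorem norm_toL2_sq_eq_sum {ψ : Torus → E3} (hψ : Continuous ψ) :
    ‖toL2 ψ‖ ^ 2 = ∑ j, ∫ x, ψ x j ^ 2 := by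
  rw [norm_toL2_sq hψ, ← integral_finsetSum _ fun j _ => integrable_of_continuous (by fun_prop)]
  simp only [EuclideanSpace.norm_sq_eq, Real.norm_eq_abs, sq_abs]

theorem vectorH1_eq_sum {ψ : Torus → E3} (hψ : IsSmooth ψ) :
    vectorH1 ψ = ∑ j, scalarH1 (fun x => ψ x j) := by
  simp only [vectorH1, scalarH1, norm_toL2_sq_eq_sum hψ.continuous, Finset.sum_add_distrib,
    norm_toL2_sq_eq_sum (hψ.pderiv _).continuous, pderiv_apply hψ]
  rw [Finset.sum_comm]

/-- The scalar inequality in each component. The constant is `3 · 343`, the factor 3 coming from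
squaring a sum of three squares. -/
theorem integral_norm_pow_four_le {ψ : Torus → E3} (hψ : IsSmooth ψ) :
    ∫ x, ‖ψ x‖ ^ 4 ≤ 1029 * vectorH1 ψ ^ 2 := by
  have hc := hψ.continuous
  have h1 : ∀ x, ‖ψ x‖ ^ 4 ≤ ∑ j, 3 * ψ x j ^ 4 := fun x => by
    have : ‖ψ x‖ ^ 4 = (‖ψ x‖ ^ 2) ^ 2 := by ring
    rw [this, EuclideanSpace.norm_sq_eq]
    simp only [Real.norm_eq_abs, sq_abs, Fin.sum_univ_three]
    nlinarith [sq_nonneg (ψ x 0 ^ 2 - ψ x 1 ^ 2), sq_nonneg (ψ x 0 ^ 2 - ψ x 2 ^ 2),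
      sq_nonneg (ψ x 1 ^ 2 - ψ x 2 ^ 2)]
  calc ∫ x, ‖ψ x‖ ^ 4 ≤ ∫ x, ∑ j, 3 * ψ x j ^ 4 :=
        integral_mono (integrable_of_continuous (by fun_prop))
          (integrable_of_continuous (by fun_prop)) h1
    _ = ∑ j, 3 * ∫ x, ψ x j ^ 4 := by
        rw [integral_finsetSum _ fun j _ => integrable_of_continuous (by fun_prop)]
        simp only [integral_const_mul]
    _ ≤ ∑ j, 3 * (343 * scalarH1 (fun x => ψ x j) ^ 2) := by
        gcongr with j
        exact integral_pow_four_le (hψ.apply j)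
    _ ≤ 1029 * vectorH1 ψ ^ 2 := by
        rw [vectorH1_eq_sum hψ]
        have h := fun j => scalarH1_nonneg (fun x => ψ x j)
        simp only [Fin.sum_univ_three]
        nlinarith [mul_nonneg (h 0) (h 1), mul_nonneg (h 0) (h 2), mul_nonneg (h 1) (h 2)]

/-- Cauchy–Schwarz for `|a|²` and `|b|²`, then the embedding in `L⁴`. This leaves the remaining
factor of the trilinear form merely in `L²`, as befits a derivative of an `H¹` field. -/
theorem norm_toL2_smul_sq_le {a b : Torus → E3} (ha : IsSmooth a) (hb : IsSmooth b) (i : Fin 3) :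
    ‖toL2 (fun x => a x i • b x)‖ ^ 2 ≤ 1029 * (vectorH1 a * vectorH1 b) := by
  have hac := ha.continuous
  have hbc := hb.continuous
  have h := integral_mul_sq_le (a := fun x => ‖a x‖ ^ 2) (b := fun x => ‖b x‖ ^ 2)
    (by fun_prop) (by fun_prop)
  have e1 : ∀ x, (‖a x‖ ^ 2) ^ 2 = ‖a x‖ ^ 4 := fun x => by ring
  have e2 : ∀ x, (‖b x‖ ^ 2) ^ 2 = ‖b x‖ ^ 4 := fun x => by ring
  simp only [e1, e2] at h
  have h2 : (∫ x, ‖a x‖ ^ 2 * ‖b x‖ ^ 2) ^ 2 ≤ (1029 * (vectorH1 a * vectorH1 b)) ^ 2 := by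
    refine h.trans ((mul_le_mul (integral_norm_pow_four_le ha) (integral_norm_pow_four_le hb)
      (integral_nonneg fun x => by positivity)
      (mul_nonneg (by norm_num) (sq_nonneg _))).trans (le_of_eq (by ring)))
  have h3 := (abs_le_of_sq_le_sq' h2
    (mul_nonneg (by norm_num) (mul_nonneg (vectorH1_nonneg a) (vectorH1_nonneg b)))).2
  refine le_trans ?_ h3
  rw [norm_toL2_sq (by fun_prop)]
  refine integral_mono (integrable_of_continuous (by fun_prop))
    (integrable_of_continuous (by fun_prop)) fun x => ?_
  simp only [norm_smul, mul_pow]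
  gcongr
  exact PiLp.norm_apply_le (a x) i

/-! ### The trilinear form of the convective term. -/

section Trilinear

/-- The trilinear form `∫ uᵢ (v · ψ)`. -/
noncomputable def tri (i : Fin 3) (u v : L2) (ψ : Torus → E3) : ℝ :=
  ∫ x, u x i * inner ℝ (v x) (ψ x)

theorem integrable_norm_mul_norm (u v : L2) :
    Integrable (fun x => ‖u x‖ * ‖v x‖) (volume : Measure Torus) :=
  (Lp.memLp u).norm.integrable_mul (Lp.memLp v).norm

theorem integral_norm_mul_norm_le (u v : L2) : ∫ x, ‖u x‖ * ‖v x‖ ≤ ‖u‖ * ‖v‖ := by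
  have h := real_inner_le_norm ((Lp.memLp u).norm.toLp) ((Lp.memLp v).norm.toLp)
  have hn : ∀ w : L2, ‖((Lp.memLp w).norm.toLp : Lp ℝ 2 (volume : Measure Torus))‖ = ‖w‖ :=
    fun w => by rw [Lp.norm_toLp, eLpNorm_norm, Lp.norm_def]
  rw [hn, hn, MeasureTheory.L2.inner_def] at h
  refine le_of_eq_of_le (integral_congr_ae ?_) h
  filter_upwards [(Lp.memLp u).norm.coeFn_toLp, (Lp.memLp v).norm.coeFn_toLp] with x h1 h2
  rw [h1, h2]
  simp [mul_comm]

theorem norm_tri_integrand_le {ψ : Torus → E3} {C : ℝ} (hC : ∀ x, ‖ψ x‖ ≤ C) (i : Fin 3)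
    (u v : L2) (x : Torus) :
    ‖u x i * inner ℝ (v x) (ψ x)‖ ≤ C * (‖u x‖ * ‖v x‖) := by
  rw [norm_mul]
  calc ‖u x i‖ * ‖(inner ℝ (v x) (ψ x) : ℝ)‖ ≤ ‖u x‖ * (‖v x‖ * C) := by
        gcongr
        · exact PiLp.norm_apply_le (u x) i
        · exact (norm_inner_le_norm _ _).trans (by gcongr; exact hC x)
    _ = _ := by ring

theorem integrable_tri {ψ : Torus → E3} (hψ : Continuous ψ) (i : Fin 3) (u v : L2) :
    Integrable (fun x => u x i * inner ℝ (v x) (ψ x)) (volume : Measure Torus) := by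
  obtain ⟨C, -, hC⟩ := exists_bound_of_continuous hψ
  refine ((integrable_norm_mul_norm u v).const_mul C).mono' ?_
    (Eventually.of_forall (norm_tri_integrand_le hC i u v))
  have h1 : AEStronglyMeasurable (fun x => u x i) (volume : Measure Torus) :=
    (EuclideanSpace.proj i : E3 →L[ℝ] ℝ).continuous.comp_aestronglyMeasurable
      (Lp.aestronglyMeasurable u)
  exact h1.mul ((Lp.aestronglyMeasurable v).inner hψ.aestronglyMeasurable)

theorem abs_tri_le {ψ : Torus → E3} {C : ℝ} (hC : ∀ x, ‖ψ x‖ ≤ C)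
    (i : Fin 3) (u v : L2) : |tri i u v ψ| ≤ C * (‖u‖ * ‖v‖) := by
  have hC0 : 0 ≤ C := (norm_nonneg _).trans (hC 0)
  refine (norm_integral_le_of_norm_le ((integrable_norm_mul_norm u v).const_mul C)
    (Eventually.of_forall (norm_tri_integrand_le hC i u v))).trans ?_
  rw [integral_const_mul]
  exact mul_le_mul_of_nonneg_left (integral_norm_mul_norm_le u v) hC0

theorem tri_sub_left {ψ : Torus → E3} (hψ : Continuous ψ) (i : Fin 3) (u u' v : L2) :
    tri i (u - u') v ψ = tri i u v ψ - tri i u' v ψ := by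
  rw [tri, tri, tri, ← integral_sub (integrable_tri hψ i u v) (integrable_tri hψ i u' v)]
  refine integral_congr_ae ?_
  filter_upwards [Lp.coeFn_sub u u'] with x hx
  rw [hx, Pi.sub_apply, PiLp.sub_apply, sub_mul]

theorem tri_sub_right {ψ : Torus → E3} (hψ : Continuous ψ) (i : Fin 3) (u v v' : L2) :
    tri i u (v - v') ψ = tri i u v ψ - tri i u v' ψ := by
  rw [tri, tri, tri, ← integral_sub (integrable_tri hψ i u v) (integrable_tri hψ i u v')]
  refine integral_congr_ae ?_
  filter_upwards [Lp.coeFn_sub v v'] with x hx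
  rw [hx, Pi.sub_apply, inner_sub_left, mul_sub]

theorem tri_sub_field {ψ ψ' : Torus → E3} (hψ : Continuous ψ) (hψ' : Continuous ψ') (i : Fin 3)
    (u v : L2) : tri i u v (fun x => ψ x - ψ' x) = tri i u v ψ - tri i u v ψ' := by
  rw [tri, tri, tri, ← integral_sub (integrable_tri hψ i u v) (integrable_tri hψ' i u v)]
  simp only [inner_sub_right, mul_sub]

theorem tri_toL2_left {a ψ : Torus → E3} (ha : Continuous a) (hψ : Continuous ψ) (i : Fin 3)
    (v : L2) : tri i (toL2 a) v ψ = inner ℝ v (toL2 fun x => a x i • ψ x) := by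
  rw [inner_toL2_right v (by fun_prop), tri]
  refine integral_congr_ae ?_
  filter_upwards [coeFn_toL2 ha] with x hx
  rw [hx, inner_smul_right]

theorem tri_toL2_right {b ψ : Torus → E3} (hb : Continuous b) (i : Fin 3) (u : L2) :
    tri i u (toL2 b) ψ = ∫ x, u x i * inner ℝ (b x) (ψ x) := by
  refine integral_congr_ae ?_
  filter_upwards [coeFn_toL2 hb] with x hx
  rw [hx]

theorem tri_toL2_comm {b ψ : Torus → E3} (hb : Continuous b) (hψ : Continuous ψ) (i : Fin 3)
    (u : L2) : tri i u (toL2 b) ψ = tri i u (toL2 ψ) b := by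
  rw [tri_toL2_right hb, tri_toL2_right hψ]
  simp only [real_inner_comm]

theorem integral_inner_adv {ψ : Torus → E3} (hψ : Continuous ψ) (u : L2) (G : Fin 3 → L2) :
    ∫ x, inner ℝ (adv u (fun i => G i) x) (ψ x) = ∑ i, tri i u (G i) ψ := by
  simp only [adv, sum_inner, real_inner_smul_left]
  exact integral_finsetSum _ fun i _ => integrable_tri hψ i u (G i)

theorem integral_inner_adv_self {G : Fin 3 → Torus → E3} (hG : ∀ i, Continuous (G i)) (u v : L2) :
    ∫ x, inner ℝ (adv u G x) (v x) = ∑ i, tri i u v (G i) := by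
  simp only [adv, sum_inner, real_inner_smul_left]
  rw [integral_finsetSum]
  · simp only [tri, real_inner_comm]
  · exact fun i _ => by simpa only [real_inner_comm] using integrable_tri (hG i) i u v

/-- Integration by parts in the trilinear form. -/
theorem sum_tri_add_sum_tri_eq_zero {u : L2} (hu : u ∈ H0) {f ψ : Torus → E3} (hf : IsSmooth f)
    (hψ : IsSmooth ψ) :
    ∑ i, tri i u (toL2 (pderiv i f)) ψ + ∑ i, tri i u (toL2 f) (pderiv i ψ) = 0 := by
  -- Test `div u = 0` with the scalar `f · ψ`, whose gradient splits by the Leibniz rule.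
  have h := mem_H0_iff.1 hu _ (hf.inner hψ)
  rw [inner_toL2_right u (grad_isSmooth (hf.inner hψ)).continuous] at h
  rw [← h, ← Finset.sum_add_distrib]
  have h1 : ∀ i, tri i u (toL2 (pderiv i f)) ψ + tri i u (toL2 f) (pderiv i ψ)
      = ∫ x, u x i * pderiv i (fun x => inner ℝ (f x) (ψ x)) x := fun i => by
    rw [tri, tri, ← integral_add (integrable_tri hψ.continuous i u _)
      (integrable_tri (hψ.pderiv i).continuous i u _)]
    refine integral_congr_ae ?_
    filter_upwards [coeFn_toL2 hf.continuous, coeFn_toL2 (hf.pderiv i).continuous] with x h1 h2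
    rw [h1, h2, pderiv_inner hf hψ]
    ring
  simp only [h1]
  rw [← integral_finsetSum]
  · refine integral_congr_ae (Eventually.of_forall fun x => ?_)
    simp [PiLp.inner_apply, grad, mul_comm]
  · intro i _
    simp only [pderiv_inner hf hψ, mul_add]
    refine Integrable.add ?_ ?_
    · refine (integrable_tri (hψ.pderiv i).continuous i u (toL2 f)).congr ?_
      filter_upwards [coeFn_toL2 hf.continuous] with x hx
      rw [hx]
    · refine (integrable_tri hψ.continuous i u (toL2 (pderiv i f))).congr ?_
      filter_upwards [coeFn_toL2 (hf.pderiv i).continuous] with x hx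
      rw [hx]

theorem tendsto_tri_left {ψ : Torus → E3} (hψ : Continuous ψ) (i : Fin 3) {a : ℕ → L2} {u : L2}
    (v : L2) (ha : Tendsto a atTop (𝓝 u)) :
    Tendsto (fun n => tri i (a n) v ψ) atTop (𝓝 (tri i u v ψ)) := by
  obtain ⟨C, -, hC⟩ := exists_bound_of_continuous hψ
  rw [tendsto_iff_norm_sub_tendsto_zero] at ha ⊢
  refine squeeze_zero (fun _ => norm_nonneg _) (fun n => ?_)
    (by simpa using (ha.mul_const ‖v‖).const_mul C)
  rw [← tri_sub_left hψ]
  exact abs_tri_le hC i _ v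

theorem tendsto_tri_right {ψ : Torus → E3} (hψ : Continuous ψ) (i : Fin 3) {a : ℕ → L2} {v : L2}
    (u : L2) (ha : Tendsto a atTop (𝓝 v)) :
    Tendsto (fun n => tri i u (a n) ψ) atTop (𝓝 (tri i u v ψ)) := by
  obtain ⟨C, -, hC⟩ := exists_bound_of_continuous hψ
  rw [tendsto_iff_norm_sub_tendsto_zero] at ha ⊢
  refine squeeze_zero (fun _ => norm_nonneg _) (fun n => ?_)
    (by simpa using (ha.const_mul ‖u‖).const_mul C)
  rw [← tri_sub_right hψ]
  exact abs_tri_le hC i u _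

/-- In contrast to `abs_tri_le`, the test field enters through its `H¹` norm and not its supremum.
Only the former is controlled along smooth approximations of an `H¹` field. -/
theorem abs_tri_toL2_le {a b : Torus → E3} (ha : IsSmooth a) (hb : IsSmooth b) (i : Fin 3)
    (v : L2) :
    |tri i (toL2 a) v b| ≤ ‖v‖ * Real.sqrt (1029 * (vectorH1 a * vectorH1 b)) := by
  rw [tri_toL2_left ha.continuous hb.continuous]
  exact (abs_real_inner_le_norm _ _).trans (mul_le_mul_of_nonneg_left
    (Real.le_sqrt_of_sq_le (norm_toL2_smul_sq_le ha hb i)) (norm_nonneg _))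

end Trilinear

/-! ### The trilinear form on fields of class `H¹`. -/

section H1

theorem exists_solenoidal_seq {u : L2} (hu : u ∈ H1) :
    ∃ ψ : ℕ → Torus → E3, (∀ n, IsSolenoidal (ψ n)) ∧
      Tendsto (fun n => toL2 (ψ n)) atTop (𝓝 u) ∧
      ∀ i, Tendsto (fun n => toL2 (pderiv i (ψ n))) atTop (𝓝 (wderiv i u)) := by
  choose ψ hψ h1 h2 using fun n : ℕ => exists_solenoidal_near hu.1
    (fun i => hasWeakPDeriv_wderiv (hu.2 i)) (ε := 1 / ((n : ℝ) + 1)) (by positivity)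
  have hlim := tendsto_one_div_add_atTop_nhds_zero_nat (𝕜 := ℝ)
  refine ⟨ψ, hψ, ?_, fun i => ?_⟩
  · rw [tendsto_iff_norm_sub_tendsto_zero]
    exact squeeze_zero (fun _ => norm_nonneg _)
      (fun n => by rw [norm_sub_rev]; exact (h1 n).le) hlim
  · rw [tendsto_iff_norm_sub_tendsto_zero]
    exact squeeze_zero (fun _ => norm_nonneg _)
      (fun n => by rw [norm_sub_rev]; exact (h2 n i).le) hlim

/-- Only the differentiated copy of `u` is replaced by smooth approximations. The advecting copy
stays fixed, since integration by parts asks of it only membership in `H0`. -/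
theorem sum_tri_wderiv {u : L2} (hu : u ∈ H1) {ψ : Torus → E3} (hψ : IsSmooth ψ) :
    ∑ i, tri i u (wderiv i u) ψ = -∑ i, tri i u u (pderiv i ψ) := by
  obtain ⟨a, ha, h1, h2⟩ := exists_solenoidal_seq hu
  have hlim := (tendsto_finsetSum Finset.univ fun i _ =>
    tendsto_tri_right hψ.continuous i u (h2 i)).add (tendsto_finsetSum Finset.univ fun i _ =>
    tendsto_tri_right (hψ.pderiv i).continuous i u h1)
  simp only [sum_tri_add_sum_tri_eq_zero hu.1 (ha _).smooth hψ] at hlim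
  have := tendsto_nhds_unique hlim tendsto_const_nhds
  linarith

/-- With `f = ψ`, the two sums in the integration by parts formula coincide. -/
theorem sum_tri_self_eq_zero {ψ : Torus → E3} (hψ : IsSmooth ψ) {u : L2} (hu : u ∈ H0) :
    ∑ i, tri i u (toL2 (pderiv i ψ)) ψ = 0 := by
  have h := sum_tri_add_sum_tri_eq_zero hu hψ hψ
  have h1 : ∀ i, tri i u (toL2 ψ) (pderiv i ψ) = tri i u (toL2 (pderiv i ψ)) ψ := fun i =>
    tri_toL2_comm hψ.continuous (hψ.pderiv i).continuous i u
  simp only [h1] at h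
  linarith

/-- The trilinear form vanishes in the limit when the test fields approximate the solution. -/
theorem tendsto_sum_tri_zero {u : L2} {ψ : ℕ → Torus → E3}
    (hψ : ∀ n, IsSolenoidal (ψ n)) (h1 : Tendsto (fun n => toL2 (ψ n)) atTop (𝓝 u))
    (h2 : ∀ i, Tendsto (fun n => toL2 (pderiv i (ψ n))) atTop (𝓝 (wderiv i u))) :
    Tendsto (fun n => ∑ i, tri i u (wderiv i u) (ψ n)) atTop (𝓝 0) := by
  set δ : ℕ → ℝ := fun k => ‖u - toL2 (ψ k)‖ ^ 2 + ∑ i, ‖wderiv i u - toL2 (pderiv i (ψ k))‖ ^ 2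
    with hδ
  have hd1 : Tendsto (fun k => u - toL2 (ψ k)) atTop (𝓝 0) := by
    simpa using h1.const_sub u
  have hd2 : ∀ i, Tendsto (fun k => wderiv i u - toL2 (pderiv i (ψ k))) atTop (𝓝 0) := fun i => by
    simpa using (h2 i).const_sub (wderiv i u)
  have hδ0 : Tendsto δ atTop (𝓝 0) := by
    have := ((hd1.norm).pow 2).add (tendsto_finsetSum Finset.univ fun i _ => (hd2 i).norm.pow 2)
    simpa [hδ] using this
  have hR : Tendsto (fun k => vectorH1 (ψ k)) atTop
      (𝓝 (‖u‖ ^ 2 + ∑ i, ‖wderiv i u‖ ^ 2)) :=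
    (h1.norm.pow 2).add (tendsto_finsetSum Finset.univ fun i _ => (h2 i).norm.pow 2)
  -- Replace the advecting `u` by `ψⱼ = (ψⱼ - ψₖ) + ψₖ`. In the part advected by `ψₖ`, subtracting
  -- `∂ᵢψₖ` from `∂ᵢu` costs nothing, because the form vanishes when all three fields are `ψₖ`. Each
  -- part then has a factor that is small for large `k`, once `j → ∞`.
  have hbound : ∀ k, |∑ i, tri i u (wderiv i u) (ψ k)| ≤
      ∑ i, ‖wderiv i u‖ * Real.sqrt (1029 * (δ k * vectorH1 (ψ k)))
      + ∑ i, ‖wderiv i u - toL2 (pderiv i (ψ k))‖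
        * Real.sqrt (1029 * (vectorH1 (ψ k) * vectorH1 (ψ k))) := by
    intro k
    have hc := (hψ k).smooth.continuous
    have hl : Tendsto (fun j => |∑ i, tri i (toL2 (ψ j)) (wderiv i u) (ψ k)|) atTop
        (𝓝 |∑ i, tri i u (wderiv i u) (ψ k)|) :=
      (tendsto_finsetSum Finset.univ fun i _ => tendsto_tri_left hc i (wderiv i u) h1).abs
    have hv : Tendsto (fun j => vectorH1 (fun x => ψ j x - ψ k x)) atTop (𝓝 (δ k)) := by
      have e : ∀ j, vectorH1 (fun x => ψ j x - ψ k x) = ‖toL2 (ψ j) - toL2 (ψ k)‖ ^ 2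
          + ∑ i, ‖toL2 (pderiv i (ψ j)) - toL2 (pderiv i (ψ k))‖ ^ 2 := fun j => by
        simp only [vectorH1, toL2_sub (hψ j).smooth.continuous hc,
          pderiv_sub (hψ j).smooth (hψ k).smooth,
          toL2_sub ((hψ j).smooth.pderiv _).continuous ((hψ k).smooth.pderiv _).continuous]
      simp only [e]
      exact ((h1.sub_const _).norm.pow 2).add
        (tendsto_finsetSum Finset.univ fun i _ => ((h2 i).sub_const _).norm.pow 2)
    have hr : Tendsto (fun j => ∑ i, ‖wderiv i u‖
          * Real.sqrt (1029 * (vectorH1 (fun x => ψ j x - ψ k x) * vectorH1 (ψ k)))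
        + ∑ i, ‖wderiv i u - toL2 (pderiv i (ψ k))‖
          * Real.sqrt (1029 * (vectorH1 (ψ k) * vectorH1 (ψ k)))) atTop
        (𝓝 (∑ i, ‖wderiv i u‖ * Real.sqrt (1029 * (δ k * vectorH1 (ψ k)))
      + ∑ i, ‖wderiv i u - toL2 (pderiv i (ψ k))‖
        * Real.sqrt (1029 * (vectorH1 (ψ k) * vectorH1 (ψ k))))) :=
      (tendsto_finsetSum Finset.univ fun i _ =>
        ((((hv.mul_const _).const_mul _).sqrt).const_mul _)).add_const _
    refine le_of_tendsto_of_tendsto' hl hr fun j => ?_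
    have hcj := (hψ j).smooth.continuous
    have hsplit : ∑ i, tri i (toL2 (ψ j)) (wderiv i u) (ψ k)
        = ∑ i, tri i (toL2 fun x => ψ j x - ψ k x) (wderiv i u) (ψ k)
          + ∑ i, tri i (toL2 (ψ k)) (wderiv i u - toL2 (pderiv i (ψ k))) (ψ k) := by
      have h0 := sum_tri_self_eq_zero (hψ k).smooth (hψ k).mem_H0
      simp only [toL2_sub hcj hc, tri_sub_left hc, tri_sub_right hc, Finset.sum_sub_distrib, h0]
      ring
    rw [hsplit]
    refine (abs_add_le _ _).trans (add_le_add ?_ ?_)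
    · exact (Finset.abs_sum_le_sum_abs _ _).trans (Finset.sum_le_sum fun i _ =>
        abs_tri_toL2_le ((hψ j).sub (hψ k)).smooth (hψ k).smooth i _)
    · exact (Finset.abs_sum_le_sum_abs _ _).trans (Finset.sum_le_sum fun i _ =>
        abs_tri_toL2_le (hψ k).smooth (hψ k).smooth i _)
  refine squeeze_zero_norm hbound ?_
  have := (tendsto_finsetSum Finset.univ fun i _ =>
      (((hδ0.mul hR).const_mul (1029 : ℝ)).sqrt).const_mul ‖wderiv i u‖).add
    (tendsto_finsetSum Finset.univ fun i (_ : i ∈ Finset.univ) =>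
      ((hd2 i).norm).mul (((hR.mul hR).const_mul (1029 : ℝ)).sqrt))
  simpa using this

end H1

/-! ### The energy identity and the uniform energy bound. -/

section Energy

/-- The energy identity. -/
theorem IsBardinaSolution.energy {γ α : ℝ} {g : L2} {u : ℝ → L2} (h : IsBardinaSolution γ α g u)
    {t : ℝ} (ht : 0 ≤ t) :
    inner ℝ (derivWithin u (Ici 0) t) (u t)
      + α * ∑ i, inner ℝ (derivWithin (fun s => wderiv i (u s)) (Ici 0) t) (wderiv i (u t))
      + γ * normSqH α (u t) = inner ℝ g (u t) := by
  -- Since `u t` is not an admissible test field, test with smooth solenoidal fields tending to it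
  -- in `H¹`; the convective term disappears in the limit.
  obtain ⟨ψ, hψ, h1, h2⟩ := exists_solenoidal_seq (h.mem t ht)
  have h3 := tendsto_sum_tri_zero hψ h1 h2
  have heq := fun n => h.eqn t ht (ψ n) (hψ n)
  simp only [integral_inner_adv (hψ _).smooth.continuous] at heq
  have hin : ∀ v : L2, Tendsto (fun n => inner ℝ v (toL2 (ψ n))) atTop (𝓝 (inner ℝ v (u t))) :=
    fun v => tendsto_const_nhds.inner h1
  have hin2 : ∀ v : Fin 3 → L2, Tendsto (fun n => ∑ i, inner ℝ (v i) (toL2 (pderiv i (ψ n)))) atTop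
      (𝓝 (∑ i, inner ℝ (v i) (wderiv i (u t)))) :=
    fun v => tendsto_finsetSum _ fun i _ => tendsto_const_nhds.inner (h2 i)
  have hl := (((hin (derivWithin u (Ici 0) t)).add ((hin2 fun i =>
    derivWithin (fun s => wderiv i (u s)) (Ici 0) t).const_mul α)).add h3).add
    (((hin (u t)).add ((hin2 fun i => wderiv i (u t)).const_mul α)).const_mul γ)
  have := tendsto_nhds_unique (hl.congr heq) (hin g)
  rw [← this]
  simp only [normSqH, real_inner_self_eq_norm_sq, add_zero]

theorem IsBardinaSolution.hasDerivWithinAt {γ α : ℝ} {g : L2} {u : ℝ → L2}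
    (h : IsBardinaSolution γ α g u) {t : ℝ} (ht : 0 ≤ t) :
    HasDerivWithinAt u (derivWithin u (Ici 0) t) (Ici 0) t :=
  (h.contDiff.differentiableOn (by simp) t ht).hasDerivWithinAt

theorem IsBardinaSolution.hasDerivWithinAt_wderiv {γ α : ℝ} {g : L2} {u : ℝ → L2}
    (h : IsBardinaSolution γ α g u) (i : Fin 3) {t : ℝ} (ht : 0 ≤ t) :
    HasDerivWithinAt (fun s => wderiv i (u s))
      (derivWithin (fun s => wderiv i (u s)) (Ici 0) t) (Ici 0) t :=
  ((h.contDiff_grad i).differentiableOn (by simp) t ht).hasDerivWithinAt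

theorem IsBardinaSolution.hasDerivWithinAt_normSqH {γ α : ℝ} {g : L2} {u : ℝ → L2}
    (h : IsBardinaSolution γ α g u) {t : ℝ} (ht : 0 ≤ t) :
    HasDerivWithinAt (fun s => normSqH α (u s))
      (2 * inner ℝ g (u t) - 2 * γ * normSqH α (u t)) (Ici 0) t := by
  have h1 := (h.hasDerivWithinAt ht).norm_sq
  have h2 := fun i => (h.hasDerivWithinAt_wderiv i ht).norm_sq
  have h3 := h1.add ((HasDerivWithinAt.fun_sum (u := Finset.univ) fun i _ => h2 i).const_mul α)
  refine h3.congr_deriv ?_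
  rw [← h.energy ht, ← Finset.mul_sum]
  simp only [real_inner_comm]
  ring

theorem sub_le_integral_of_hasDerivWithinAt_Ici {f f' k : ℝ → ℝ} {a b : ℝ} (ha : 0 ≤ a)
    (hab : a ≤ b) (hf : ∀ s, 0 ≤ s → HasDerivWithinAt f (f' s) (Ici 0) s)
    (hk : IntervalIntegrable k volume a b) (hle : ∀ s ∈ Icc a b, f' s ≤ k s) :
    f b - f a ≤ ∫ s in a..b, k s := by
  refine intervalIntegral.sub_le_integral_of_hasDeriv_right_of_le hab
    (fun s hs => ((hf s (ha.trans hs.1)).continuousWithinAt).mono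
      fun r hr => ha.trans hr.1) (g' := f')
    (fun s hs => (hf s (ha.trans hs.1.le)).mono fun r hr => ?_)
    ((intervalIntegrable_iff_integrableOn_Icc_of_le hab).1 hk)
    (fun s hs => hle s ⟨hs.1.le, hs.2.le⟩)
  exact (ha.trans hs.1.le).trans (le_of_lt hr)

/-- By Young's inequality the damping absorbs the forcing: `2(g, u) - 2γ‖u‖² ≤ ‖g‖²/(2γ)`. The
linear growth is harmless, as only bounds on finite time intervals that are uniform in `α` are
needed. -/
theorem IsBardinaSolution.normSqH_le {γ α : ℝ} {g : L2} {u : ℝ → L2} (hγ : 0 < γ) (hα : 0 ≤ α)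
    (h : IsBardinaSolution γ α g u) {t : ℝ} (ht : 0 ≤ t) :
    normSqH α (u t) ≤ normSqH α (u 0) + t * (‖g‖ ^ 2 / (2 * γ)) := by
  have := sub_le_integral_of_hasDerivWithinAt_Ici le_rfl ht
    (fun s hs => h.hasDerivWithinAt_normSqH hs) (k := fun _ => ‖g‖ ^ 2 / (2 * γ)) (by simp)
    (fun s _ => by
      have h1 := real_inner_le_norm g (u s)
      have h2 : ‖u s‖ ^ 2 ≤ normSqH α (u s) := by unfold normSqH; simp; positivity
      rw [le_div_iff₀ (by positivity)]
      nlinarith [sq_nonneg (‖g‖ - 2 * γ * ‖u s‖), mul_le_mul_of_nonneg_left h2 (sq_nonneg γ)])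
  simp only [intervalIntegral.integral_const, smul_eq_mul, sub_zero] at this
  linarith

end Energy

/-! ### Smooth space-time fields as differentiable curves in `L²`. -/

section Curves

/-- A vector field on `[0, ∞) × 𝕋` that is smooth up to the boundary. -/
def IsSmoothCurve (φ : ℝ → Torus → E3) : Prop :=
  ContDiffOn ℝ ∞ (fun p : ℝ × (Fin 3 → ℝ) => φ p.1 (toTorus p.2)) (Ici 0 ×ˢ univ)

/-- The time derivative of a vector field on `[0, ∞) × 𝕋`. -/
noncomputable def timeDeriv (φ : ℝ → Torus → E3) : ℝ → Torus → E3 :=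
  fun t x => derivWithin (fun s => φ s x) (Ici 0) t

theorem uniqueDiffOn_Ici_prod_univ :
    UniqueDiffOn ℝ ((Ici 0 : Set ℝ) ×ˢ (univ : Set (Fin 3 → ℝ))) :=
  (uniqueDiffOn_Ici 0).prod uniqueDiffOn_univ

variable {φ : ℝ → Torus → E3}

theorem IsSmoothCurve.isSmooth (hφ : IsSmoothCurve φ) {t : ℝ} (ht : 0 ≤ t) : IsSmooth (φ t) := by
  have h : ContDiff ℝ ∞ (fun y : Fin 3 → ℝ => ((t, y) : ℝ × (Fin 3 → ℝ))) := by fun_prop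
  exact ContDiffOn.comp_contDiff (g := fun p : ℝ × (Fin 3 → ℝ) => φ p.1 (toTorus p.2)) hφ h
    fun y => ⟨ht, mem_univ _⟩

theorem IsSmoothCurve.hasFDerivWithinAt (hφ : IsSmoothCurve φ) {t : ℝ} (ht : 0 ≤ t)
    (y : Fin 3 → ℝ) :
    HasFDerivWithinAt (fun p : ℝ × (Fin 3 → ℝ) => φ p.1 (toTorus p.2))
      (fderivWithin ℝ (fun p : ℝ × (Fin 3 → ℝ) => φ p.1 (toTorus p.2)) (Ici 0 ×ˢ univ) (t, y))
      (Ici 0 ×ˢ univ) (t, y) :=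
  (ContDiffOn.differentiableOn hφ (by simp) (t, y) ⟨ht, mem_univ _⟩).hasFDerivWithinAt

theorem IsSmoothCurve.pderiv_toTorus (hφ : IsSmoothCurve φ) (i : Fin 3) {t : ℝ} (ht : 0 ≤ t)
    (y : Fin 3 → ℝ) : pderiv i (φ t) (toTorus y) =
      fderivWithin ℝ (fun p : ℝ × (Fin 3 → ℝ) => φ p.1 (toTorus p.2)) (Ici 0 ×ˢ univ) (t, y)
        (0, Pi.single i 1) := by
  have h1 : HasDerivWithinAt (fun s : ℝ => ((t, y + s • Pi.single i 1) : ℝ × (Fin 3 → ℝ)))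
      (0, Pi.single i 1) univ 0 := by
    rw [hasDerivWithinAt_univ]
    refine (hasDerivAt_const _ _).prodMk ?_
    simpa using ((hasDerivAt_id (0 : ℝ)).smul_const (Pi.single i 1 : Fin 3 → ℝ)).const_add y
  have h2 := hφ.hasFDerivWithinAt ht (y + (0 : ℝ) • Pi.single i 1)
  have hm : MapsTo (fun s : ℝ => ((t, y + s • Pi.single i 1) : ℝ × (Fin 3 → ℝ))) univ
      (Ici 0 ×ˢ univ) := fun s _ => ⟨ht, mem_univ _⟩
  have h3 := h2.comp_hasDerivWithinAt (0 : ℝ) h1 hm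
  rw [hasDerivWithinAt_univ, zero_smul, add_zero] at h3
  simp only [pderiv, toTorus_add_single]
  exact h3.deriv

theorem IsSmoothCurve.hasDerivWithinAt_toTorus (hφ : IsSmoothCurve φ) {t : ℝ} (ht : 0 ≤ t)
    (y : Fin 3 → ℝ) : HasDerivWithinAt (fun s => φ s (toTorus y))
      (fderivWithin ℝ (fun p : ℝ × (Fin 3 → ℝ) => φ p.1 (toTorus p.2)) (Ici 0 ×ˢ univ) (t, y)
        (1, 0)) (Ici 0) t := by
  have h1 : HasDerivWithinAt (fun s : ℝ => ((s, y) : ℝ × (Fin 3 → ℝ))) (1, 0) (Ici 0) t :=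
    (hasDerivWithinAt_id t _).prodMk (hasDerivWithinAt_const _ _ _)
  have hm : MapsTo (fun s : ℝ => ((s, y) : ℝ × (Fin 3 → ℝ))) (Ici 0) (Ici 0 ×ˢ univ) :=
    fun s hs => ⟨hs, mem_univ _⟩
  exact (hφ.hasFDerivWithinAt ht y).comp_hasDerivWithinAt t h1 hm

theorem IsSmoothCurve.timeDeriv_toTorus (hφ : IsSmoothCurve φ) {t : ℝ} (ht : 0 ≤ t)
    (y : Fin 3 → ℝ) : timeDeriv φ t (toTorus y) =
      fderivWithin ℝ (fun p : ℝ × (Fin 3 → ℝ) => φ p.1 (toTorus p.2)) (Ici 0 ×ˢ univ) (t, y)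
        (1, 0) :=
  (hφ.hasDerivWithinAt_toTorus ht y).derivWithin (uniqueDiffOn_Ici 0 t ht)

theorem IsSmoothCurve.hasDerivWithinAt (hφ : IsSmoothCurve φ) {t : ℝ} (ht : 0 ≤ t) (x : Torus) :
    HasDerivWithinAt (fun s => φ s x) (timeDeriv φ t x) (Ici 0) t := by
  obtain ⟨y, rfl⟩ := toTorus_surjective x
  rw [hφ.timeDeriv_toTorus ht]
  exact hφ.hasDerivWithinAt_toTorus ht y

theorem IsSmoothCurve.contDiffOn_fderivWithin_apply (hφ : IsSmoothCurve φ)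
    (e : ℝ × (Fin 3 → ℝ)) :
    ContDiffOn ℝ ∞ (fun p => fderivWithin ℝ (fun p : ℝ × (Fin 3 → ℝ) => φ p.1 (toTorus p.2))
      (Ici 0 ×ˢ univ) p e) (Ici 0 ×ˢ univ) :=
  (ContDiffOn.fderivWithin hφ uniqueDiffOn_Ici_prod_univ (by simp)).clm_apply contDiffOn_const

theorem IsSmoothCurve.pderiv (hφ : IsSmoothCurve φ) (i : Fin 3) :
    IsSmoothCurve (fun t => DampedEuler.pderiv i (φ t)) :=
  (hφ.contDiffOn_fderivWithin_apply _).congr fun p hp => hφ.pderiv_toTorus i hp.1 p.2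

theorem IsSmoothCurve.timeDeriv (hφ : IsSmoothCurve φ) :
    IsSmoothCurve (DampedEuler.timeDeriv φ) :=
  (hφ.contDiffOn_fderivWithin_apply _).congr fun p hp => hφ.timeDeriv_toTorus hp.1 p.2

theorem IsSmoothCurve.adv (hφ : IsSmoothCurve φ) :
    IsSmoothCurve (fun t => DampedEuler.adv (φ t) (fun i => DampedEuler.pderiv i (φ t))) := by
  unfold IsSmoothCurve DampedEuler.adv
  refine ContDiffOn.sum fun i _ => ?_
  have h : ContDiffOn ℝ ∞ (fun p : ℝ × (Fin 3 → ℝ) => φ p.1 (toTorus p.2) i) (Ici 0 ×ˢ univ) :=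
    (EuclideanSpace.proj i : E3 →L[ℝ] ℝ).contDiff.comp_contDiffOn hφ
  exact h.smul (hφ.pderiv i)

/-- The field is frozen at its initial value for negative times. This gives a continuous map on all
of `ℝ × 𝕋` that can be curried, so that continuity in time becomes uniform in space. -/
theorem IsSmoothCurve.continuous_uncurry (hφ : IsSmoothCurve φ) :
    Continuous fun p : ℝ × Torus => φ (max p.1 0) p.2 := by
  have hq : IsOpenQuotientMap (Prod.map (id : ℝ → ℝ) toTorus) :=
    IsOpenQuotientMap.id.prodMap isOpenQuotientMap_toTorus
  rw [hq.isQuotientMap.continuous_iff]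
  have h : Continuous fun p : ℝ × (Fin 3 → ℝ) => (max p.1 0, p.2) := by fun_prop
  exact (ContDiffOn.continuousOn hφ).comp_continuous h fun p =>
    ⟨mem_Ici.2 (le_max_right p.1 0), mem_univ _⟩

/-- A smooth vector field on `[0, ∞) × 𝕋` as a curve of continuous fields. -/
noncomputable def IsSmoothCurve.curve (hφ : IsSmoothCurve φ) : C(ℝ, C(Torus, E3)) :=
  ContinuousMap.curry ⟨fun p : ℝ × Torus => φ (max p.1 0) p.2, hφ.continuous_uncurry⟩

theorem IsSmoothCurve.curve_apply (hφ : IsSmoothCurve φ) {t : ℝ} (ht : 0 ≤ t) :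
    (hφ.curve t : Torus → E3) = φ t := by
  funext x
  change φ (max t 0) x = φ t x
  rw [max_eq_left ht]

theorem IsSmoothCurve.toLp_curve (hφ : IsSmoothCurve φ) {t : ℝ} (ht : 0 ≤ t) :
    ContinuousMap.toLp 2 volume ℝ (hφ.curve t) = toL2 (φ t) := by
  rw [toLp_eq_toL2, hφ.curve_apply ht]

theorem IsSmoothCurve.continuousOn_toL2 (hφ : IsSmoothCurve φ) :
    ContinuousOn (fun t => toL2 (φ t)) (Ici 0) :=
  ((ContinuousLinearMap.continuous _).comp hφ.curve.continuous).continuousOn.congr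
    fun _ ht => (hφ.toLp_curve ht).symm

/-- The fundamental theorem of calculus at each point `x`, with evaluation at `x` commuting with the
integral. It upgrades the pointwise time derivative to one in the supremum norm, and hence in `L²`.
-/
theorem IsSmoothCurve.curve_eq_integral (hφ : IsSmoothCurve φ) {t : ℝ} (ht : 0 ≤ t) :
    hφ.curve t = hφ.curve 0 + ∫ s in (0 : ℝ)..t, hφ.timeDeriv.curve s := by
  refine ContinuousMap.ext fun x => ?_
  have h1 := (ContinuousMap.evalCLM ℝ x : C(Torus, E3) →L[ℝ] E3).intervalIntegral_comp_comm
    (hφ.timeDeriv.curve.continuous.intervalIntegrable (μ := volume) 0 t)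
  simp only [ContinuousMap.evalCLM_apply] at h1
  rw [ContinuousMap.add_apply, ← h1, hφ.curve_apply ht, hφ.curve_apply le_rfl]
  have h2 : ∫ s in (0 : ℝ)..t, hφ.timeDeriv.curve s x = φ t x - φ 0 x := by
    refine intervalIntegral.integral_eq_sub_of_hasDeriv_right_of_le ht
      (f := fun s => φ s x) (fun s hs => ?_) (fun s hs => ?_) ?_
    · exact (hφ.hasDerivWithinAt hs.1 x).continuousWithinAt.mono fun r hr => hr.1
    · rw [hφ.timeDeriv.curve_apply hs.1.le]
      exact (hφ.hasDerivWithinAt hs.1.le x).mono fun r hr => hs.1.le.trans (le_of_lt hr)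
    · have : Continuous fun s => hφ.timeDeriv.curve s x :=
        (ContinuousMap.evalCLM ℝ x : C(Torus, E3) →L[ℝ] E3).continuous.comp
          hφ.timeDeriv.curve.continuous
      exact this.intervalIntegrable _ _
  rw [h2]
  abel

theorem IsSmoothCurve.hasDerivWithinAt_toL2 (hφ : IsSmoothCurve φ) {t : ℝ} (ht : 0 ≤ t) :
    HasDerivWithinAt (fun s => toL2 (φ s)) (toL2 (DampedEuler.timeDeriv φ t)) (Ici 0) t := by
  have h1 : HasDerivAt (fun s => hφ.curve 0 + ∫ r in (0 : ℝ)..s, hφ.timeDeriv.curve r)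
      (hφ.timeDeriv.curve t) t :=
    ((hφ.timeDeriv.curve.continuous.integral_hasStrictDerivAt 0 t).hasDerivAt).const_add _
  have h2 := (ContinuousMap.toLp 2 (volume : Measure Torus) ℝ :
    C(Torus, E3) →L[ℝ] L2).hasFDerivAt.comp_hasDerivAt t h1
  rw [hφ.timeDeriv.toLp_curve ht] at h2
  refine h2.hasDerivWithinAt.congr (fun s hs => ?_) ?_
  · rw [Function.comp_apply, ← hφ.curve_eq_integral hs, hφ.toLp_curve hs]
  · rw [Function.comp_apply, ← hφ.curve_eq_integral ht, hφ.toLp_curve ht]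

theorem IsSmoothCurve.eventually_norm_sub_le (hφ : IsSmoothCurve φ) {t : ℝ} (ht : 0 ≤ t) {ε : ℝ}
    (hε : 0 < ε) : ∀ᶠ s in 𝓝[Ici 0] t, ∀ x, ‖φ s x - φ t x‖ ≤ ε := by
  have h := Metric.tendsto_nhds.1 (hφ.curve.continuous.continuousAt (x := t)) ε hε
  filter_upwards [mem_nhdsWithin_of_mem_nhds h, self_mem_nhdsWithin] with s hs hs0 x
  rw [← hφ.curve_apply hs0, ← hφ.curve_apply ht, ← dist_eq_norm]
  exact (ContinuousMap.dist_apply_le_dist x).trans (le_of_lt hs)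

theorem IsTestField.isSmoothCurve (hφ : IsTestField φ) : IsSmoothCurve φ := hφ.smooth

theorem IsTestField.isSolenoidal (hφ : IsTestField φ) {t : ℝ} (ht : 0 ≤ t) :
    IsSolenoidal (φ t) :=
  ⟨hφ.isSmoothCurve.isSmooth ht, hφ.div_free t ht⟩

end Curves

/-! ### Boundedness, sign and continuity of `e₀(φ)`. -/

section StrainRate

variable {φ : ℝ → Torus → E3}

theorem e0_eq (hφ : IsSmoothCurve φ) {t : ℝ} (ht : 0 ≤ t) :
    e0 φ t = ⨆ z : {z : L2 // z ∈ H0 ∧ z ≠ 0},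
      -(∑ i, tri i z.1 z.1 (pderiv i (φ t))) / ‖z.1‖ ^ 2 := by
  simp only [e0, integral_inner_adv_self fun i => ((hφ.isSmooth ht).pderiv i).continuous]

theorem neg_sum_tri_div_le {G : Fin 3 → Torus → E3} {C : ℝ} (hC : ∀ i x, ‖G i x‖ ≤ C) (z : L2) :
    -(∑ i, tri i z z (G i)) / ‖z‖ ^ 2 ≤ 3 * C := by
  have hC0 : 0 ≤ C := (norm_nonneg _).trans (hC 0 0)
  refine div_le_of_le_mul₀ (sq_nonneg _) (by positivity) ?_
  have h : ∀ i, -(C * (‖z‖ * ‖z‖)) ≤ tri i z z (G i) := fun i =>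
    (abs_le.1 (abs_tri_le (hC i) i z z)).1
  rw [Fin.sum_univ_three]
  linarith [h 0, h 1, h 2]

/-- Needed before `e0` can serve as an upper bound: a real supremum over an unbounded family takes
the default value 0. -/
theorem bddAbove_e0 (hφ : IsSmoothCurve φ) {t : ℝ} (ht : 0 ≤ t) :
    BddAbove (range fun z : {z : L2 // z ∈ H0 ∧ z ≠ 0} =>
      -(∑ i, tri i z.1 z.1 (pderiv i (φ t))) / ‖z.1‖ ^ 2) := by
  choose C hC0 hC using fun i =>
    exists_bound_of_continuous ((hφ.isSmooth ht).pderiv i).continuous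
  refine ⟨3 * ∑ i, C i, ?_⟩
  rintro _ ⟨z, rfl⟩
  exact neg_sum_tri_div_le (fun i x => (hC i x).trans
    (Finset.single_le_sum (fun j _ => hC0 j) (Finset.mem_univ i))) z.1

theorem neg_sum_tri_le_e0 (hφ : IsSmoothCurve φ) {t : ℝ} (ht : 0 ≤ t) {z : L2} (hz : z ∈ H0) :
    -(∑ i, tri i z z (pderiv i (φ t))) ≤ e0 φ t * ‖z‖ ^ 2 := by
  by_cases h0 : z = 0
  · have h : ∀ i, tri i z z (pderiv i (φ t)) = 0 := fun i => by
      obtain ⟨C, -, hC⟩ := exists_bound_of_continuous ((hφ.isSmooth ht).pderiv i).continuous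
      have := abs_tri_le hC i z z
      simpa [h0] using this
    simp only [h]
    simp [h0]
  · rw [← div_le_iff₀ (by positivity), e0_eq hφ ht]
    exact le_ciSup (bddAbove_e0 hφ ht) ⟨z, hz, h0⟩

theorem toL2_const_ne_zero {c : E3} (hc : c ≠ 0) : toL2 (fun _ => c) ≠ 0 := fun h => by
  have h1 := coeFn_toL2 (continuous_const (y := c) (X := Torus))
  rw [h] at h1
  have h2 := (Continuous.ae_eq_iff_eq (volume : Measure Torus) continuous_const
    continuous_const).1 ((Lp.coeFn_zero E3 2 (volume : Measure Torus)).symm.trans h1)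
  exact hc (congrFun h2 0).symm

theorem exists_const_mem_H0 : ∃ c : E3, toL2 (fun _ => c) ∈ H0 ∧ toL2 (fun _ => c) ≠ 0 :=
  ⟨EuclideanSpace.single 0 1, (IsSolenoidal.const _).mem_H0, toL2_const_ne_zero (by simp)⟩

instance nonempty_nonzero_H0 : Nonempty {z : L2 // z ∈ H0 ∧ z ≠ 0} :=
  let ⟨_, h⟩ := exists_const_mem_H0
  ⟨⟨_, h⟩⟩

/-- The quadratic form vanishes on constant fields, by integration by parts. The sign is what later
allows `e₀‖w‖²` to be replaced by the larger `e₀` times the full `𝓗_α` norm squared. -/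
theorem e0_nonneg (hφ : IsSmoothCurve φ) {t : ℝ} (ht : 0 ≤ t) : 0 ≤ e0 φ t := by
  obtain ⟨c, hc, hc0⟩ := exists_const_mem_H0
  have h := sum_tri_add_sum_tri_eq_zero hc (IsSmooth.const c) (hφ.isSmooth ht)
  have h1 : ∀ i, tri i (toL2 fun _ => c) (toL2 fun _ => 0) (φ t) = 0 := fun i => by
    rw [tri_toL2_right continuous_const]
    simp
  simp only [pderiv_const, h1, Finset.sum_const_zero, zero_add] at h
  have h2 := neg_sum_tri_le_e0 hφ ht hc
  rw [h, neg_zero] at h2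
  exact nonneg_of_mul_nonneg_left h2 (by positivity)

/-- Each quotient is linear in the gradient of `φ`, so the supremum is Lipschitz in it; the factor 3
counts the directions. -/
theorem e0_le_add (hφ : IsSmoothCurve φ) {s t : ℝ} (hs : 0 ≤ s) (ht : 0 ≤ t) {ε : ℝ}
    (h : ∀ i x, ‖pderiv i (φ s) x - pderiv i (φ t) x‖ ≤ ε) : e0 φ s ≤ e0 φ t + 3 * ε := by
  rw [e0_eq hφ hs]
  refine ciSup_le fun z => ?_
  have h1 := neg_sum_tri_div_le h z.1
  have h2 : -(∑ i, tri i z.1 z.1 (pderiv i (φ t))) / ‖z.1‖ ^ 2 ≤ e0 φ t := by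
    rw [e0_eq hφ ht]
    exact le_ciSup (bddAbove_e0 hφ ht) z
  have h3 : ∀ i, tri i z.1 z.1 (fun x => pderiv i (φ s) x - pderiv i (φ t) x)
      = tri i z.1 z.1 (pderiv i (φ s)) - tri i z.1 z.1 (pderiv i (φ t)) := fun i =>
    tri_sub_field ((hφ.isSmooth hs).pderiv i).continuous ((hφ.isSmooth ht).pderiv i).continuous i
      z.1 z.1
  simp only [h3, Finset.sum_sub_distrib] at h1
  rw [neg_sub, sub_div] at h1
  rw [neg_div] at h2 ⊢
  linarith

theorem continuousOn_e0 (hφ : IsSmoothCurve φ) : ContinuousOn (e0 φ) (Ici 0) := by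
  intro t ht
  rw [ContinuousWithinAt, Metric.tendsto_nhds]
  intro ε hε
  -- With `ε / 6` the Lipschitz bound gives `ε / 2`, which is strictly less than `ε`.
  have h := eventually_all.2 fun i => (hφ.pderiv i).eventually_norm_sub_le ht
    (ε := ε / 6) (by positivity)
  filter_upwards [h, self_mem_nhdsWithin] with s hs hs0
  have h1 := e0_le_add hφ hs0 ht hs
  have h2 := e0_le_add hφ ht hs0 fun i x => by rw [norm_sub_rev]; exact hs i x
  rw [Real.dist_eq, abs_lt]
  constructor <;> linarith

end StrainRate

/-! ### The residual `D₀(φ)` and the convective term about a smooth field. -/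

section Residual

variable {φ : ℝ → Torus → E3}

theorem inner_leray {w : L2} (hw : w ∈ H0) (a : L2) : inner ℝ (leray a) w = inner ℝ a w := by
  rw [leray, Submodule.inner_starProjection_left_eq_right,
    Submodule.starProjection_eq_self_iff.2 hw]

theorem inner_leray_right {w : L2} (hw : w ∈ H0) (a : L2) :
    inner ℝ w (leray a) = inner ℝ w a := by
  rw [real_inner_comm, inner_leray hw, real_inner_comm]

/-- Against elements of `H0` the Leray projectors drop out. -/
theorem inner_D0 (γ : ℝ) (g : L2) (φ : ℝ → Torus → E3) (t : ℝ) {w : L2} (hw : w ∈ H0) :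
    inner ℝ (D0 γ g φ t) w = inner ℝ (toL2 (timeDeriv φ t)) w
      + inner ℝ (toL2 (adv (φ t) (fun i => pderiv i (φ t)))) w
      + γ * inner ℝ (toL2 (φ t)) w - inner ℝ g w := by
  rw [D0, inner_sub_left, inner_add_left, inner_add_left, inner_leray hw, inner_leray hw,
    real_inner_smul_left]
  rfl

theorem continuousOn_D0 (γ : ℝ) (g : L2) (hφ : IsSmoothCurve φ) :
    ContinuousOn (D0 γ g φ) (Ici 0) := by
  have h1 := hφ.timeDeriv.continuousOn_toL2
  have h2 := leray.continuous.comp_continuousOn hφ.adv.continuousOn_toL2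
  have h3 := hφ.continuousOn_toL2.const_smul γ
  exact ((h1.add h2).add h3).sub continuousOn_const

theorem sum_tri_toL2_left {a : Torus → E3} {G : Fin 3 → Torus → E3} (ha : Continuous a)
    (hG : ∀ i, Continuous (G i)) (w : L2) :
    ∑ i, tri i (toL2 a) w (G i) = inner ℝ (toL2 (adv a G)) w := by
  have hadv : Continuous (adv a G) := by unfold adv; fun_prop
  rw [← integral_inner_adv_self hG, real_inner_comm, inner_toL2_right w hadv]
  refine integral_congr_ae ?_
  filter_upwards [coeFn_toL2 ha] with x hx
  simp only [adv, hx, real_inner_comm]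

/-- The quadratic form of the convective term, expanded about a smooth field. -/
theorem sum_tri_self_eq {u : L2} (hu : u ∈ H0) {ψ : Torus → E3} (hψ : IsSolenoidal ψ) :
    ∑ i, tri i u u (pderiv i ψ)
      = ∑ i, tri i (u - toL2 ψ) (u - toL2 ψ) (pderiv i ψ)
        + inner ℝ (toL2 (adv ψ (fun i => pderiv i ψ))) (u - toL2 ψ) := by
  have hc := hψ.smooth.continuous
  have hcd := fun i => (hψ.smooth.pderiv i).continuous
  -- With `w = u - ψ`, this makes `∫ uᵢ (u · ∂ᵢψ)` equal to `∫ uᵢ (w · ∂ᵢψ)` after summation.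
  -- Splitting `u = w + ψ` in the advecting factor then gives the two terms.
  have h0 : ∑ i, tri i u (toL2 ψ) (pderiv i ψ) = 0 := by
    rw [← sum_tri_self_eq_zero hψ.smooth hu]
    exact Finset.sum_congr rfl fun i _ => tri_toL2_comm hc (hcd i) i u
  rw [← sum_tri_toL2_left hc hcd, ← Finset.sum_add_distrib]
  have h1 : ∀ i, tri i (u - toL2 ψ) (u - toL2 ψ) (pderiv i ψ)
      + tri i (toL2 ψ) (u - toL2 ψ) (pderiv i ψ)
      = tri i u u (pderiv i ψ) - tri i u (toL2 ψ) (pderiv i ψ) := fun i => by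
    rw [tri_sub_left (hcd i), ← tri_sub_right (hcd i)]
    ring
  simp only [h1, Finset.sum_sub_distrib, h0, sub_zero]

end Residual

/-! ### The relative energy balance. -/

section RelativeEnergy

variable {φ : ℝ → Torus → E3} {γ α : ℝ} {g : L2} {u : ℝ → L2}

theorem wderiv_sub_toL2 {v : L2} (hv : v ∈ H1) {ψ : Torus → E3} (hψ : IsSmooth ψ) (i : Fin 3) :
    wderiv i (v - toL2 ψ) = wderiv i v - toL2 (pderiv i ψ) :=
  ((hasWeakPDeriv_wderiv (hv.2 i)).sub (hasWeakPDeriv_toL2 hψ i)).wderiv_eq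

theorem normSqH_sub_toL2 {v : L2} (hv : v ∈ H1) {ψ : Torus → E3} (hψ : IsSmooth ψ) :
    normSqH α (v - toL2 ψ)
      = ‖v - toL2 ψ‖ ^ 2 + α * ∑ i, ‖wderiv i v - toL2 (pderiv i ψ)‖ ^ 2 := by
  simp only [normSqH, wderiv_sub_toL2 hv hψ]

/-- The error term in the relative energy balance. -/
noncomputable def gradError (γ : ℝ) (φ : ℝ → Torus → E3) (u : ℝ → L2) (t : ℝ) : ℝ :=
  ∑ i, inner ℝ (γ • toL2 (pderiv i (φ t)) + toL2 (timeDeriv (fun s => pderiv i (φ s)) t))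
    (wderiv i (u t) - toL2 (pderiv i (φ t)))

/-- The relative energy balance. -/
theorem IsBardinaSolution.hasDerivWithinAt_relative (h : IsBardinaSolution γ α g u)
    (hφ : IsTestField φ) {t : ℝ} (ht : 0 ≤ t) :
    HasDerivWithinAt (fun s => normSqH α (u s - toL2 (φ s)))
      (-2 * γ * normSqH α (u t - toL2 (φ t))
        - 2 * ∑ i, tri i (u t - toL2 (φ t)) (u t - toL2 (φ t)) (pderiv i (φ t))
        - 2 * inner ℝ (D0 γ g φ t) (u t - toL2 (φ t)) - 2 * α * gradError γ φ u t) (Ici 0) t := by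
  have hφc := hφ.isSmoothCurve
  have h1 := ((h.hasDerivWithinAt ht).sub (hφc.hasDerivWithinAt_toL2 ht)).norm_sq
  have h2 := fun i => ((h.hasDerivWithinAt_wderiv i ht).sub
    ((hφc.pderiv i).hasDerivWithinAt_toL2 ht)).norm_sq
  have h3 := h1.add ((HasDerivWithinAt.fun_sum (u := Finset.univ) fun i _ => h2 i).const_mul α)
  have h4 : ∀ s ∈ Ici (0 : ℝ), normSqH α (u s - toL2 (φ s)) = ‖u s - toL2 (φ s)‖ ^ 2
      + α * ∑ i, ‖wderiv i (u s) - toL2 (pderiv i (φ s))‖ ^ 2 :=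
    fun s hs => normSqH_sub_toL2 (h.mem s hs) (hφc.isSmooth hs)
  refine (h3.congr h4 (h4 t ht)).congr_deriv ?_
  -- The balance is twice the difference of the energy identity and the equation tested with `φ(t)`,
  -- whose convective term is integrated by parts and expanded about `φ`. The contributions of `φ`
  -- carrying a factor `α` are absent from `D0` and collect in `gradError`.
  have hA := h.energy ht
  have hB := h.eqn t ht (φ t) (hφ.isSolenoidal ht)
  rw [integral_inner_adv (hφc.isSmooth ht).continuous,
    sum_tri_wderiv (h.mem t ht) (hφc.isSmooth ht),
    sum_tri_self_eq (h.mem t ht).1 (hφ.isSolenoidal ht)] at hB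
  have hw : u t - toL2 (φ t) ∈ H0 :=
    Submodule.sub_mem _ (h.mem t ht).1 (hφ.isSolenoidal ht).mem_H0
  rw [inner_D0 γ g φ t hw, h4 t ht, gradError]
  simp only [Pi.sub_apply]
  have hn : ∀ a b : L2, ‖a - b‖ ^ 2 = ‖a‖ ^ 2 - 2 * inner ℝ a b + ‖b‖ ^ 2 := norm_sub_sq_real
  have e1 : inner ℝ (toL2 (φ t)) (u t) = inner ℝ (u t) (toL2 (φ t)) := real_inner_comm _ _
  have e2 : ∀ i, inner ℝ (toL2 (pderiv i (φ t))) (wderiv i (u t))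
      = inner ℝ (wderiv i (u t)) (toL2 (pderiv i (φ t))) := fun i => real_inner_comm _ _
  rw [← Finset.mul_sum]
  rw [real_inner_comm _ (u t - toL2 (φ t))]
  simp only [real_inner_comm _ (wderiv _ (u t) - toL2 (pderiv _ (φ t)))]
  simp only [normSqH] at hA
  generalize ∑ i, tri i (u t - toL2 (φ t)) (u t - toL2 (φ t)) (pderiv i (φ t)) = T at hB ⊢
  generalize inner ℝ (toL2 (adv (φ t) fun i => pderiv i (φ t))) (u t - toL2 (φ t)) = S at hB ⊢
  simp only [hn, inner_sub_left, inner_sub_right, inner_add_left, real_inner_smul_left, e1, e2,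
    real_inner_self_eq_norm_sq, Finset.sum_sub_distrib, Finset.sum_add_distrib,
    ← Finset.mul_sum] at hA hB ⊢
  linear_combination 2 * hA - 2 * hB

end RelativeEnergy

/-! ### Gronwall's inequality for the relative energy. -/

section Gronwall

variable {φ : ℝ → Torus → E3} {γ α : ℝ} {g : L2} {u : ℝ → L2}

/-- The weight `e^{-2∫_s^b (γ - e₀(φ)(r)) dr}`. -/
noncomputable def weight (γ : ℝ) (φ : ℝ → Torus → E3) (b s : ℝ) : ℝ :=
  Real.exp (-2 * ∫ r in s..b, (γ - e0 φ r))

theorem intervalIntegrable_e0 (hφ : IsSmoothCurve φ) {a b : ℝ} (ha : 0 ≤ a) (hb : 0 ≤ b) :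
    IntervalIntegrable (e0 φ) volume a b :=
  ((continuousOn_e0 hφ).mono fun _ hs => (le_min ha hb).trans hs.1).intervalIntegrable

theorem hasDerivWithinAt_weight (γ : ℝ) (hφ : IsSmoothCurve φ) {b : ℝ} (hb : 0 ≤ b) {s : ℝ}
    (hs : 0 ≤ s) :
    HasDerivWithinAt (weight γ φ b) (weight γ φ b s * (2 * (γ - e0 φ s))) (Ici 0) s := by
  -- Extending `e0` by a constant to negative times makes the two-sided fundamental theorem
  -- applicable at `s = 0` as well.
  have hc : Continuous fun r => γ - e0 φ (max r 0) :=
    continuous_const.sub ((continuousOn_e0 hφ).comp_continuous (by fun_prop)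
      fun r => mem_Ici.2 (le_max_right r 0))
  have h1 : HasDerivAt (fun s => ∫ r in s..b, (γ - e0 φ (max r 0))) (-(γ - e0 φ (max s 0))) s :=
    intervalIntegral.integral_hasDerivAt_left (hc.intervalIntegrable _ _)
      (hc.stronglyMeasurableAtFilter _ _) hc.continuousAt
  have h2 : ∀ s ∈ Ici (0 : ℝ), weight γ φ b s
      = Real.exp (-2 * ∫ r in s..b, (γ - e0 φ (max r 0))) := fun s hs => by
    rw [weight]
    congr 2
    refine intervalIntegral.integral_congr fun r hr => ?_
    have : 0 ≤ r := (le_min hs hb).trans hr.1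
    simp only [max_eq_left this]
  have h3 := ((h1.const_mul (-2)).exp.hasDerivWithinAt (s := Ici 0)).congr h2 (h2 s hs)
  refine h3.congr_deriv ?_
  rw [← h2 s hs, max_eq_left hs]
  ring

theorem continuousOn_weight (γ : ℝ) (hφ : IsSmoothCurve φ) {b : ℝ} (hb : 0 ≤ b) :
    ContinuousOn (weight γ φ b) (Ici 0) :=
  fun _ hs => (hasDerivWithinAt_weight γ hφ hb hs).continuousWithinAt

theorem continuousOn_dissIntegrand (γ : ℝ) (g : L2) (hφ : IsSmoothCurve φ) {b : ℝ} (hb : 0 ≤ b)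
    (hu : ContinuousOn u (Ici 0)) : ContinuousOn (dissIntegrand γ g u φ b) (Ici 0) :=
  (continuousOn_weight γ hφ hb).mul
    ((continuousOn_D0 γ g hφ).inner (hu.sub hφ.continuousOn_toL2))

/-- The part of the error in the relative energy balance that depends on the test field only. -/
noncomputable def fieldError (γ : ℝ) (φ : ℝ → Torus → E3) (t : ℝ) : ℝ :=
  ∑ i, ‖γ • toL2 (pderiv i (φ t)) + toL2 (timeDeriv (fun s => pderiv i (φ s)) t)‖ ^ 2

theorem continuousOn_fieldError (γ : ℝ) (hφ : IsSmoothCurve φ) :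
    ContinuousOn (fieldError γ φ) (Ici 0) :=
  continuousOn_finsetSum _ fun i _ => (((hφ.pderiv i).continuousOn_toL2.const_smul γ).add
    (hφ.pderiv i).timeDeriv.continuousOn_toL2).norm.pow 2

/-- Young's inequality in the form `2α|a||b| = √α · 2|a|(√α|b|) ≤ √α (|a|² + α|b|²)`. The second
summand is part of the relative energy, so the whole error is of order `√α`. -/
theorem neg_gradError_le (hα : 0 < α) (γ : ℝ) (φ : ℝ → Torus → E3) (u : ℝ → L2) (t : ℝ) :
    -(2 * α * gradError γ φ u t) ≤ Real.sqrt α * (fieldError γ φ t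
      + α * ∑ i, ‖wderiv i (u t) - toL2 (pderiv i (φ t))‖ ^ 2) := by
  rw [gradError, fieldError, Finset.mul_sum, Finset.mul_sum, ← Finset.sum_add_distrib,
    Finset.mul_sum, ← Finset.sum_neg_distrib]
  refine Finset.sum_le_sum fun i _ => ?_
  generalize γ • toL2 (pderiv i (φ t)) + toL2 (timeDeriv (fun s => pderiv i (φ s)) t) = a
  generalize wderiv i (u t) - toL2 (pderiv i (φ t)) = b
  have h1 := (abs_le.1 (abs_real_inner_le_norm a b)).1
  have h2 : Real.sqrt α ^ 2 = α := Real.sq_sqrt hα.le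
  have h3 : 0 ≤ Real.sqrt α * (‖a‖ - Real.sqrt α * ‖b‖) ^ 2 :=
    mul_nonneg (Real.sqrt_nonneg _) (sq_nonneg _)
  have h4 : Real.sqrt α * (‖a‖ - Real.sqrt α * ‖b‖) ^ 2
      = Real.sqrt α * (‖a‖ ^ 2 + Real.sqrt α ^ 2 * ‖b‖ ^ 2)
        - 2 * Real.sqrt α ^ 2 * (‖a‖ * ‖b‖) := by ring
  rw [h4, h2] at h3
  nlinarith [mul_le_mul_of_nonneg_left h1 hα.le]

/-- The relative energy estimate. -/
theorem relative_energy_le (hφ : IsTestField φ) {a b : ℝ} (ha : 0 ≤ a) (hab : a ≤ b) (γ : ℝ)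
    (g : L2) (C : ℝ) :
    ∃ B, ∀ α u, 0 < α → IsBardinaSolution γ α g u →
      (∀ s ∈ Icc a b, normSqH α (u s - toL2 (φ s)) ≤ C) →
      normSqH α (u b - toL2 (φ b)) ≤ normSqH α (u a - toL2 (φ a)) * weight γ φ b a
        + (-2 * (∫ s in a..b, dissIntegrand γ g u φ b s) + Real.sqrt α * B) := by
  have hφc := hφ.isSmoothCurve
  have hb := ha.trans hab
  have hsub : Icc a b ⊆ Ici 0 := fun s hs => ha.trans hs.1
  -- The bound is chosen before `α` and `u`; the solution enters only through the energy bound `C`.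
  obtain ⟨B, hB⟩ := isCompact_Icc.exists_bound_of_continuousOn
    (f := fun s => weight γ φ b s * (fieldError γ φ s + C)) (s := Icc a b)
    (((continuousOn_weight γ hφc hb).mul
      ((continuousOn_fieldError γ hφc).add continuousOn_const)).mono hsub)
  refine ⟨(b - a) * B, fun α u hα h hE => ?_⟩
  have hcu : ContinuousOn u (Ici 0) := h.contDiff.continuousOn
  have hdiss : IntervalIntegrable (dissIntegrand γ g u φ b) volume a b :=
    ((continuousOn_dissIntegrand γ g hφc hb hcu).mono
      (by rw [uIcc_of_le hab]; exact hsub)).intervalIntegrable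
  -- The weight is an integrating factor: its derivative cancels the damping `-2γE` and leaves
  -- `-2e₀E`, which compensates the quadratic convective term.
  have hmain := sub_le_integral_of_hasDerivWithinAt_Ici ha hab
    (fun s hs => (h.hasDerivWithinAt_relative hφ hs).mul (hasDerivWithinAt_weight γ hφc hb hs))
    (k := fun s => -2 * dissIntegrand γ g u φ b s + Real.sqrt α * B)
    ((hdiss.const_mul (-2)).add (by simp)) (fun s hs => ?_)
  · rw [intervalIntegral.integral_add (hdiss.const_mul (-2)) (by simp),
      intervalIntegral.integral_const_mul, intervalIntegral.integral_const] at hmain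
    have hw : weight γ φ b b = 1 := by simp [weight]
    simp only [Pi.mul_apply, hw, mul_one, smul_eq_mul] at hmain
    linarith
  · have hs0 : 0 ≤ s := hsub hs
    have hwH0 : u s - toL2 (φ s) ∈ H0 :=
      Submodule.sub_mem _ (h.mem s hs0).1 (hφ.isSolenoidal hs0).mem_H0
    have h1 := neg_sum_tri_le_e0 hφc hs0 hwH0
    have h2 := neg_gradError_le hα γ φ u s
    have h3 := normSqH_sub_toL2 (α := α) (h.mem s hs0) (hφc.isSmooth hs0)
    have h4 := hE s hs
    have h5 := (le_abs_self _).trans (hB s hs)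
    have he := e0_nonneg hφc hs0
    have hP : 0 < weight γ φ b s := Real.exp_pos _
    have hG : 0 ≤ α * ∑ i, ‖wderiv i (u s) - toL2 (pderiv i (φ s))‖ ^ 2 := by positivity
    have hd : dissIntegrand γ g u φ b s
        = weight γ φ b s * inner ℝ (D0 γ g φ s) (u s - toL2 (φ s)) := rfl
    rw [hd]
    set E := normSqH α (u s - toL2 (φ s))
    set P := weight γ φ b s
    set G := α * ∑ i, ‖wderiv i (u s) - toL2 (pderiv i (φ s))‖ ^ 2
    set T := ∑ i, tri i (u s - toL2 (φ s)) (u s - toL2 (φ s)) (pderiv i (φ s))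
    set D := inner ℝ (D0 γ g φ s) (u s - toL2 (φ s))
    have h6 : -T ≤ e0 φ s * E := h1.trans (mul_le_mul_of_nonneg_left (by linarith) he)
    have h7 : -(2 * α * gradError γ φ u s) ≤ Real.sqrt α * (fieldError γ φ s + C) :=
      h2.trans (mul_le_mul_of_nonneg_left (by linarith [sq_nonneg ‖u s - toL2 (φ s)‖])
        (Real.sqrt_nonneg _))
    have h8 : Real.sqrt α * (P * (fieldError γ φ s + C)) ≤ Real.sqrt α * B :=
      mul_le_mul_of_nonneg_left h5 (Real.sqrt_nonneg _)
    calc _ = P * (-(2 * T) - 2 * e0 φ s * E - 2 * D - 2 * α * gradError γ φ u s) := by ring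
      _ ≤ P * (-2 * D + Real.sqrt α * (fieldError γ φ s + C)) :=
        mul_le_mul_of_nonneg_left (by linarith) hP.le
      _ = -2 * (P * D) + Real.sqrt α * (P * (fieldError γ φ s + C)) := by ring
      _ ≤ _ := by linarith

end Gronwall

/-! ### Uniform bounds and limits along approximating sequences. -/

section Approximation

variable {φ : ℝ → Torus → E3} {γ : ℝ} {g : L2} {α : ℕ → ℝ} {u : ℕ → ℝ → L2} {ũ : ℝ → L2}

theorem Approximates.exists_bound (hγ : 0 < γ) (h : Approximates γ g α u ũ) (T : ℝ) :
    ∃ C, 0 ≤ C ∧ ∀ n t, 0 ≤ t → t ≤ T → normSqH (α n) (u n t) ≤ C := by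
  obtain ⟨C, hC⟩ := h.bounded
  refine ⟨|C| + |T| * (‖g‖ ^ 2 / (2 * γ)), by positivity, fun n t ht htT => ?_⟩
  refine ((h.solution n).normSqH_le hγ (h.pos n).le ht).trans (add_le_add ?_ ?_)
  · exact (hC n).trans (le_abs_self C)
  · exact mul_le_mul_of_nonneg_right (htT.trans (le_abs_self T)) (by positivity)

theorem norm_sq_le_normSqH {α : ℝ} (hα : 0 ≤ α) (v : L2) : ‖v‖ ^ 2 ≤ normSqH α v :=
  le_add_of_nonneg_right (by positivity)

theorem normSqH_sub_toL2_le {α : ℝ} (hα : 0 ≤ α) {v : L2} (hv : v ∈ H1) {ψ : Torus → E3}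
    (hψ : IsSmooth ψ) : normSqH α (v - toL2 ψ)
      ≤ 2 * normSqH α v + 2 * (‖toL2 ψ‖ ^ 2 + α * ∑ i, ‖toL2 (pderiv i ψ)‖ ^ 2) := by
  have h : ∀ a b : L2, ‖a - b‖ ^ 2 ≤ 2 * ‖a‖ ^ 2 + 2 * ‖b‖ ^ 2 := fun a b => by
    have := parallelogram_law_with_norm ℝ a b
    nlinarith [sq_nonneg ‖a + b‖]
  rw [normSqH_sub_toL2 hv hψ, normSqH]
  have h1 : ∑ i, ‖wderiv i v - toL2 (pderiv i ψ)‖ ^ 2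
      ≤ 2 * ∑ i, ‖wderiv i v‖ ^ 2 + 2 * ∑ i, ‖toL2 (pderiv i ψ)‖ ^ 2 := by
    rw [Finset.mul_sum, Finset.mul_sum, ← Finset.sum_add_distrib]
    exact Finset.sum_le_sum fun i _ => h _ _
  nlinarith [h v (toL2 ψ), mul_le_mul_of_nonneg_left h1 hα]

theorem Approximates.exists_bound_relative (hγ : 0 < γ) (h : Approximates γ g α u ũ)
    (hφ : IsSmoothCurve φ) (T : ℝ) :
    ∃ C, 0 ≤ C ∧ ∀ n t, 0 ≤ t → t ≤ T → normSqH (α n) (u n t - toL2 (φ t)) ≤ C := by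
  obtain ⟨C, hC0, hC⟩ := h.exists_bound hγ T
  obtain ⟨A, hA⟩ := h.tendsto_zero.bddAbove_range
  have hA' : ∀ n, α n ≤ A := fun n => hA ⟨n, rfl⟩
  have hA0 : 0 ≤ A := (h.pos 0).le.trans (hA' 0)
  obtain ⟨B, hB⟩ := isCompact_Icc.exists_bound_of_continuousOn (s := Icc 0 T)
    (f := fun t => ‖toL2 (φ t)‖ ^ 2 + A * ∑ i, ‖toL2 (pderiv i (φ t))‖ ^ 2)
    ((((hφ.continuousOn_toL2).norm.pow 2).add ((continuousOn_finsetSum _ fun i _ =>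
      (hφ.pderiv i).continuousOn_toL2.norm.pow 2).const_mul A)).mono fun t ht => ht.1)
  refine ⟨2 * C + 2 * |B|, by positivity, fun n t ht htT => ?_⟩
  refine (normSqH_sub_toL2_le (h.pos n).le ((h.solution n).mem t ht) (hφ.isSmooth ht)).trans
    (add_le_add (by linarith [hC n t ht htT]) ?_)
  refine mul_le_mul_of_nonneg_left (le_trans ?_ (((le_abs_self _).trans
    (hB t ⟨ht, htT⟩)).trans (le_abs_self B))) (by norm_num)
  gcongr
  exact hA' n

/-- Weak convergence is assumed only against `H0`. As all the fields lie in `H0`, any `w` may be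
replaced by its Leray projection. -/
theorem Approximates.tendsto_inner (h : Approximates γ g α u ũ) (hũ : ∀ t, 0 ≤ t → ũ t ∈ H0)
    {t : ℝ} (ht : 0 ≤ t) (w : L2) :
    Tendsto (fun n => inner ℝ (u n t) w) atTop (𝓝 (inner ℝ (ũ t) w)) := by
  have h1 := h.weak t ht (leray w) (Submodule.starProjection_apply_mem _ _)
  rw [inner_leray_right (hũ t ht)] at h1
  refine h1.congr fun n => ?_
  rw [inner_leray_right ((h.solution n).mem t ht).1]

theorem Approximates.tendsto_dissIntegrand (h : Approximates γ g α u ũ)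
    (hũ : ∀ t, 0 ≤ t → ũ t ∈ H0) (b : ℝ) {s : ℝ} (hs : 0 ≤ s) :
    Tendsto (fun n => dissIntegrand γ g (u n) φ b s) atTop (𝓝 (dissIntegrand γ g ũ φ b s)) := by
  unfold dissIntegrand
  simp only [inner_sub_right]
  refine Tendsto.const_mul _ (Tendsto.sub_const ?_ _)
  simp only [real_inner_comm _ (D0 γ g φ s)]
  exact h.tendsto_inner hũ hs _

theorem Approximates.exists_bound_dissIntegrand (hγ : 0 < γ) (h : Approximates γ g α u ũ)
    (hφ : IsSmoothCurve φ) {a b : ℝ} (ha : 0 ≤ a) (hb : 0 ≤ b) :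
    ∃ K, ∀ n, ∀ s ∈ Icc a b, ‖dissIntegrand γ g (u n) φ b s‖ ≤ K := by
  obtain ⟨C, hC0, hC⟩ := h.exists_bound_relative hγ hφ b
  obtain ⟨B, hB⟩ := isCompact_Icc.exists_bound_of_continuousOn (s := Icc a b)
    (f := fun s => weight γ φ b s * ‖D0 γ g φ s‖)
    (((continuousOn_weight γ hφ hb).mul (continuousOn_D0 γ g hφ).norm).mono
      fun s hs => ha.trans hs.1)
  refine ⟨B * Real.sqrt C, fun n s hs => ?_⟩
  have hs0 : 0 ≤ s := ha.trans hs.1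
  have h1 : ‖u n s - toL2 (φ s)‖ ≤ Real.sqrt C :=
    Real.le_sqrt_of_sq_le ((norm_sq_le_normSqH (h.pos n).le _).trans (hC n s hs0 hs.2))
  have h2 := hB s hs
  have hP : 0 < weight γ φ b s := Real.exp_pos _
  rw [norm_mul, norm_norm, Real.norm_of_nonneg hP.le] at h2
  have hd : dissIntegrand γ g (u n) φ b s
    = weight γ φ b s * inner ℝ (D0 γ g φ s) (u n s - toL2 (φ s)) := rfl
  rw [hd, norm_mul, Real.norm_of_nonneg hP.le]
  calc _ ≤ weight γ φ b s * (‖D0 γ g φ s‖ * ‖u n s - toL2 (φ s)‖) := by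
        gcongr; exact norm_inner_le_norm _ _
    _ = weight γ φ b s * ‖D0 γ g φ s‖ * ‖u n s - toL2 (φ s)‖ := by ring
    _ ≤ B * Real.sqrt C := mul_le_mul h2 h1 (norm_nonneg _) ((by positivity : (0 : ℝ) ≤
        weight γ φ b s * ‖D0 γ g φ s‖).trans h2)

/-- The trajectory `ũ` is only a pointwise weak limit, with no regularity in time assumed.
Measurability and boundedness of its integrand are inherited from the continuous integrands of the
`u n`, and the integrals converge by dominated convergence. -/
theorem Approximates.integrable_and_tendsto_integral_dissIntegrand (hγ : 0 < γ)
    (h : Approximates γ g α u ũ) (hũ : ∀ t, 0 ≤ t → ũ t ∈ H0) (hφ : IsSmoothCurve φ) {a b : ℝ}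
    (ha : 0 ≤ a) (hab : a ≤ b) :
    IntervalIntegrable (dissIntegrand γ g ũ φ b) volume a b ∧
      Tendsto (fun n => ∫ s in a..b, dissIntegrand γ g (u n) φ b s) atTop
        (𝓝 (∫ s in a..b, dissIntegrand γ g ũ φ b s)) := by
  obtain ⟨K, hK⟩ := h.exists_bound_dissIntegrand hγ hφ ha (ha.trans hab)
  have hmeas : ∀ n, AEStronglyMeasurable (dissIntegrand γ g (u n) φ b)
      (volume.restrict (uIoc a b)) := fun n => by
    rw [uIoc_of_le hab]
    exact ((continuousOn_dissIntegrand γ g hφ (ha.trans hab)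
      (h.solution n).contDiff.continuousOn).mono
      fun s hs => ha.trans hs.1.le).aestronglyMeasurable measurableSet_Ioc
  have hlim : ∀ s ∈ uIoc a b, Tendsto (fun n => dissIntegrand γ g (u n) φ b s) atTop
      (𝓝 (dissIntegrand γ g ũ φ b s)) := fun s hs => by
    rw [uIoc_of_le hab] at hs
    exact h.tendsto_dissIntegrand hũ b (ha.trans hs.1.le)
  have hbound : ∀ n, ∀ s ∈ uIoc a b, ‖dissIntegrand γ g (u n) φ b s‖ ≤ K := fun n s hs => by
    rw [uIoc_of_le hab] at hs
    exact hK n s ⟨hs.1.le, hs.2⟩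
  constructor
  · rw [intervalIntegrable_iff]
    refine IntegrableOn.of_bound (by simp [uIoc_of_le hab])
      (aestronglyMeasurable_of_tendsto_ae atTop hmeas
        ((ae_restrict_iff' measurableSet_uIoc).2 (Eventually.of_forall hlim))) K
      ((ae_restrict_iff' measurableSet_uIoc).2 (Eventually.of_forall fun s hs => ?_))
    exact le_of_tendsto (hlim s hs).norm (Eventually.of_forall fun n => hbound n s hs)
  · exact intervalIntegral.tendsto_integral_filter_of_dominated_convergence (fun _ => K)
      (Eventually.of_forall hmeas)
      (Eventually.of_forall fun n => Eventually.of_forall fun s hs => hbound n s hs)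
      (by simp) (Eventually.of_forall hlim)

end Approximation

/-! ### Properties of the `M`-functional. -/

section Functional

variable {φ : ℝ → Torus → E3} {γ : ℝ} {g : L2} {α : ℕ → ℝ} {u : ℕ → ℝ → L2} {ũ : ℝ → L2}

/-- The liminf of a sum is at most a limsup plus a liminf; the convergent summand supplies the
limsup. Finiteness of `d` excludes the indeterminate sums of `EReal`. -/
theorem liminf_coe_le_mul_add {X Y d' : ℕ → ℝ} {c d : ℝ} (hc : 0 < c)
    (hd : Tendsto d' atTop (𝓝 d)) (h : ∀ n, Y n ≤ X n * c + d' n) :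
    liminf (fun n => (Y n : EReal)) atTop
      ≤ liminf (fun n => (X n : EReal)) atTop * (c : EReal) + (d : EReal) := by
  have hd' : limsup (fun n => (d' n : EReal)) atTop = d :=
    ((continuous_coe_real_ereal.tendsto d).comp hd).limsup_eq
  have hX : liminf (fun n => (c : EReal) * (X n : EReal)) atTop
      = c * liminf (fun n => (X n : EReal)) atTop :=
    EReal.liminf_const_mul_of_nonneg_of_ne_top (EReal.coe_nonneg.2 hc.le) (EReal.coe_ne_top c)
  calc liminf (fun n => (Y n : EReal)) atTop
      ≤ liminf ((fun n => (d' n : EReal)) + fun n => (c : EReal) * (X n : EReal)) atTop := by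
        refine liminf_le_liminf (Eventually.of_forall fun n => ?_)
        rw [Pi.add_apply, ← EReal.coe_mul, ← EReal.coe_add, EReal.coe_le_coe_iff]
        linarith [h n]
    _ ≤ limsup (fun n => (d' n : EReal)) atTop
        + liminf (fun n => (c : EReal) * (X n : EReal)) atTop :=
        EReal.liminf_add_le (by simp [hd']) (by simp [hd'])
    _ = _ := by rw [hd', hX, add_comm, mul_comm]

theorem Approximates.M_le_liminf (h : Approximates γ g α u ũ) {φ : ℝ → Torus → E3} {t : ℝ} :
    M γ g ũ φ t
      ≤ liminf (fun n => ((normSqH (α n) (u n t - toL2 (φ t)) : ℝ) : EReal)) atTop :=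
  (iInf_le _ α).trans ((iInf_le _ u).trans (iInf_le _ h))

/-- A comparison principle for the `M`-functional. -/
theorem M_le_mul_add {φ ψ : ℝ → Torus → E3} {s t c d : ℝ} (hc : 0 < c)
    (h : ∀ α u, Approximates γ g α u ũ → ∃ d' : ℕ → ℝ, Tendsto d' atTop (𝓝 d) ∧
      ∀ n, normSqH (α n) (u n t - toL2 (φ t)) ≤ normSqH (α n) (u n s - toL2 (ψ s)) * c + d' n) :
    M γ g ũ φ t ≤ M γ g ũ ψ s * (c : EReal) + (d : EReal) := by
  have hc' : (0 : EReal) < c := EReal.coe_pos.2 hc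
  -- Since `c` is positive and finite and `d` is finite, the affine map can be inverted in `EReal`.
  -- This isolates the infimum on the right, to be bounded below sequence by sequence.
  rw [← EReal.sub_le_iff_le_add (by simp) (by simp), mul_comm,
    ← EReal.div_le_iff_le_mul hc' (EReal.coe_ne_top c)]
  refine le_iInf fun α => le_iInf fun u => le_iInf fun hu => ?_
  rw [EReal.div_le_iff_le_mul hc' (EReal.coe_ne_top c), mul_comm,
    EReal.sub_le_iff_le_add (by simp) (by simp)]
  obtain ⟨d', hd', hle⟩ := h α u hu
  exact hu.M_le_liminf.trans
    (liminf_coe_le_mul_add hc hd' hle)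

/-- One approximating sequence with its uniform energy bound suffices. The value `⊥` is excluded
separately by `norm_sq_le_M`. -/
theorem M_ne_top (hγ : 0 < γ) (h : Approximates γ g α u ũ) (hφ : IsSmoothCurve φ) {t : ℝ}
    (ht : 0 ≤ t) : M γ g ũ φ t ≠ ⊤ := by
  obtain ⟨C, -, hC⟩ := h.exists_bound_relative hγ hφ t
  refine ne_top_of_le_ne_top (EReal.coe_ne_top C)
    (h.M_le_liminf.trans ?_)
  refine (liminf_le_liminf (v := fun _ => (C : EReal))
    (Eventually.of_forall fun n => EReal.coe_le_coe_iff.2 (hC n t ht le_rfl))).trans ?_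
  rw [liminf_const]

/-- Weak lower semicontinuity of the norm, from `‖v‖² ≥ 2(v, w) - ‖w‖²` with `w` the weak limit; the
gradient part of the norm is discarded. -/
theorem norm_sq_le_M (hũ : ∀ t, 0 ≤ t → ũ t ∈ H0) (φ : ℝ → Torus → E3) {t : ℝ} (ht : 0 ≤ t) :
    ((‖ũ t - toL2 (φ t)‖ ^ 2 : ℝ) : EReal) ≤ M γ g ũ φ t := by
  refine le_iInf fun α => le_iInf fun u => le_iInf fun h => ?_
  set w := ũ t - toL2 (φ t)
  have hlim : Tendsto (fun n => 2 * inner ℝ (u n t - toL2 (φ t)) w - ‖w‖ ^ 2) atTop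
      (𝓝 (‖w‖ ^ 2)) := by
    have h1 := (((h.tendsto_inner hũ ht w).sub_const (inner ℝ (toL2 (φ t)) w)).const_mul 2).sub_const
      (‖w‖ ^ 2)
    rw [← inner_sub_left, real_inner_self_eq_norm_sq] at h1
    simp only [← inner_sub_left] at h1
    convert h1 using 2
    ring
  rw [← ((continuous_coe_real_ereal.tendsto _).comp hlim).liminf_eq]
  refine liminf_le_liminf (Eventually.of_forall fun n => EReal.coe_le_coe_iff.2 ?_)
  refine le_trans ?_ (norm_sq_le_normSqH (h.pos n).le _)
  have := sq_nonneg ‖u n t - toL2 (φ t) - w‖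
  rw [norm_sub_sq_real] at this
  linarith

theorem IsBardinaSolution.shift {γ α : ℝ} {u : ℝ → L2} (hs : IsBardinaSolution γ α g u) {h : ℝ}
    (hh : 0 ≤ h) : IsBardinaSolution γ α g (DampedEuler.shift h u) := by
  have hmaps : MapsTo (fun t => t + h) (Ici (0 : ℝ)) (Ici 0) := fun t ht => add_nonneg ht hh
  have hcd : ContDiffOn ℝ 1 (fun t : ℝ => t + h) (Ici 0) := by fun_prop
  have hderiv : ∀ {v : ℝ → L2}, ContDiffOn ℝ 1 v (Ici 0) → ∀ {t : ℝ}, 0 ≤ t →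
      derivWithin (fun t => v (t + h)) (Ici 0) t = derivWithin v (Ici 0) (t + h) := by
    intro v hv t ht
    have h1 : HasDerivWithinAt (fun t : ℝ => t + h) 1 (Ici 0) t :=
      (hasDerivWithinAt_id t _).add_const h
    have h2 := ((hv.differentiableOn (by simp) (t + h)
      (add_nonneg ht hh)).hasDerivWithinAt.scomp t h1 hmaps)
    rw [one_smul] at h2
    exact h2.derivWithin (uniqueDiffOn_Ici 0 t ht)
  refine ⟨fun t ht => hs.mem _ (add_nonneg ht hh), hs.contDiff.comp hcd hmaps,
    fun i => (hs.contDiff_grad i).comp hcd hmaps, fun t ht ψ hψ => ?_⟩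
  rw [← hs.eqn (t + h) (add_nonneg ht hh) ψ hψ, ← hderiv hs.contDiff ht]
  simp only [← hderiv (hs.contDiff_grad _) ht]
  rfl

/-- The new initial data are the values at time `h`, and their uniform boundedness is the energy
estimate. -/
theorem Approximates.shift (hγ : 0 < γ) (happ : Approximates γ g α u ũ) {h : ℝ} (hh : 0 ≤ h) :
    Approximates γ g α (fun n => DampedEuler.shift h (u n)) (DampedEuler.shift h ũ) := by
  refine ⟨happ.pos, happ.tendsto_zero, fun n => (happ.solution n).shift hh, ?_,
    fun t ht w hw => happ.weak (t + h) (add_nonneg ht hh) w hw⟩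
  obtain ⟨C, -, hC⟩ := happ.exists_bound hγ h
  exact ⟨C, fun n => hC n _ (by simpa using hh) (by simp)⟩

/-- The infimum on the left includes the shifts of all approximating sequences of `ũ`. -/
theorem M_shift_le (hγ : 0 < γ) (φ : ℝ → Torus → E3) (t : ℝ) {h : ℝ} (hh : 0 ≤ h) :
    M γ g (shift h ũ) (shift h φ) t ≤ M γ g ũ φ (t + h) :=
  le_iInf fun _ => le_iInf fun _ => le_iInf fun happ =>
    (happ.shift hγ hh).M_le_liminf

theorem normSqH_sub_toL2_eq {α : ℝ} {v : L2} (hv : v ∈ H1) {ψ : Torus → E3} (hψ : IsSmooth ψ) :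
    normSqH α (v - toL2 ψ) = normSqH α v + (‖toL2 ψ‖ ^ 2 - 2 * inner ℝ v (toL2 ψ))
      + α * ∑ i, (‖toL2 (pderiv i ψ)‖ ^ 2 - 2 * inner ℝ (wderiv i v) (toL2 (pderiv i ψ))) := by
  rw [normSqH_sub_toL2 hv hψ, normSqH, norm_sub_sq_real]
  simp only [norm_sub_sq_real, Finset.sum_add_distrib, Finset.sum_sub_distrib]
  ring

/-- Although the gradients need not stay bounded, `√α ‖∇u‖` does, so a pairing linear in the
gradient and multiplied by `α` is of order `√α`. -/
theorem Approximates.tendsto_grad_zero (hγ : 0 < γ) (h : Approximates γ g α u ũ) {t : ℝ}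
    (ht : 0 ≤ t) (a : Fin 3 → L2) :
    Tendsto (fun n => α n * ∑ i, (‖a i‖ ^ 2 - 2 * inner ℝ (wderiv i (u n t)) (a i)))
      atTop (𝓝 0) := by
  obtain ⟨C, -, hC⟩ := h.exists_bound hγ t
  have hsqrt : Tendsto (fun n => Real.sqrt (α n)) atTop (𝓝 0) := by
    simpa using h.tendsto_zero.sqrt
  refine squeeze_zero_norm (a := fun n => α n * ∑ i, ‖a i‖ ^ 2
    + Real.sqrt (α n) * (∑ i, ‖a i‖ ^ 2 + C)) (fun n => ?_) ?_
  · have hα := h.pos n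
    have h1 : α n * ∑ i, ‖wderiv i (u n t)‖ ^ 2 ≤ C := by
      have := hC n t ht le_rfl
      rw [normSqH] at this
      linarith [sq_nonneg ‖u n t‖]
    have h2 : ∀ i, α n * (2 * |inner ℝ (wderiv i (u n t)) (a i)|)
        ≤ Real.sqrt (α n) * (‖a i‖ ^ 2 + α n * ‖wderiv i (u n t)‖ ^ 2) := fun i => by
      have h3 := abs_real_inner_le_norm (wderiv i (u n t)) (a i)
      have h4 : Real.sqrt (α n) ^ 2 = α n := Real.sq_sqrt hα.le
      have h5 : 0 ≤ Real.sqrt (α n) * (‖a i‖ - Real.sqrt (α n) * ‖wderiv i (u n t)‖) ^ 2 :=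
        mul_nonneg (Real.sqrt_nonneg _) (sq_nonneg _)
      have h6 : Real.sqrt (α n) * (‖a i‖ - Real.sqrt (α n) * ‖wderiv i (u n t)‖) ^ 2
          = Real.sqrt (α n) * (‖a i‖ ^ 2 + Real.sqrt (α n) ^ 2 * ‖wderiv i (u n t)‖ ^ 2)
            - 2 * Real.sqrt (α n) ^ 2 * (‖wderiv i (u n t)‖ * ‖a i‖) := by ring
      rw [h6, h4] at h5
      nlinarith [mul_le_mul_of_nonneg_left h3 hα.le]
    calc ‖α n * ∑ i, (‖a i‖ ^ 2 - 2 * inner ℝ (wderiv i (u n t)) (a i))‖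
        ≤ α n * ∑ i, (‖a i‖ ^ 2 + 2 * |inner ℝ (wderiv i (u n t)) (a i)|) := by
          rw [norm_mul, Real.norm_of_nonneg hα.le]
          refine mul_le_mul_of_nonneg_left ((norm_sum_le _ _).trans
            (Finset.sum_le_sum fun i _ => (norm_sub_le _ _).trans (le_of_eq ?_))) hα.le
          simp [Real.norm_eq_abs]
      _ = α n * ∑ i, ‖a i‖ ^ 2 + ∑ i, α n * (2 * |inner ℝ (wderiv i (u n t)) (a i)|) := by
          rw [Finset.sum_add_distrib, mul_add, Finset.mul_sum (s := Finset.univ)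
            (f := fun i => 2 * |inner ℝ (wderiv i (u n t)) (a i)|)]
      _ ≤ α n * ∑ i, ‖a i‖ ^ 2
          + ∑ i, Real.sqrt (α n) * (‖a i‖ ^ 2 + α n * ‖wderiv i (u n t)‖ ^ 2) :=
          add_le_add le_rfl (Finset.sum_le_sum fun i _ => h2 i)
      _ ≤ _ := by
          rw [← Finset.mul_sum, Finset.sum_add_distrib, ← Finset.mul_sum]
          gcongr
  · simpa using (h.tendsto_zero.mul_const _).add (hsqrt.mul_const _)

/-- Along every approximating sequence, `‖uₙ - φ‖² - ‖uₙ‖²` in `𝓗_{αₙ}` tends to the same number,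
determined by `ũ` and `φ`. The comparison principle with `c = 1` applies in both directions. -/
theorem M_eq_add (hγ : 0 < γ) (hũ : ∀ t, 0 ≤ t → ũ t ∈ H0) (hφ : IsSmoothCurve φ) {t : ℝ}
    (ht : 0 ≤ t) : M γ g ũ φ t = M γ g ũ (fun _ _ => 0) t
      + ((‖toL2 (φ t)‖ ^ 2 - 2 * inner ℝ (ũ t) (toL2 (φ t)) : ℝ) : EReal) := by
  have hsm := hφ.isSmooth ht
  have hr : ∀ α u, Approximates γ g α u ũ → Tendsto (fun n =>
      (‖toL2 (φ t)‖ ^ 2 - 2 * inner ℝ (u n t) (toL2 (φ t)))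
        + α n * ∑ i, (‖toL2 (pderiv i (φ t))‖ ^ 2
          - 2 * inner ℝ (wderiv i (u n t)) (toL2 (pderiv i (φ t))))) atTop
      (𝓝 (‖toL2 (φ t)‖ ^ 2 - 2 * inner ℝ (ũ t) (toL2 (φ t)))) := fun α u h => by
    simpa using (((h.tendsto_inner hũ ht (toL2 (φ t))).const_mul 2).const_sub
      (‖toL2 (φ t)‖ ^ 2)).add (h.tendsto_grad_zero hγ ht fun i => toL2 (pderiv i (φ t)))
  set d := ‖toL2 (φ t)‖ ^ 2 - 2 * inner ℝ (ũ t) (toL2 (φ t))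
  refine le_antisymm ?_ ?_
  · have h1 := M_le_mul_add (γ := γ) (g := g) (ũ := ũ) (φ := φ) (ψ := fun _ _ => 0) (s := t)
      (t := t) (d := d) one_pos fun α u h => ⟨_, hr α u h, fun n => by
        rw [toL2_zero, sub_zero, mul_one, normSqH_sub_toL2_eq ((h.solution n).mem t ht) hsm,
          add_assoc]⟩
    simpa using h1
  · have h1 := M_le_mul_add (γ := γ) (g := g) (ũ := ũ) (φ := fun _ _ => 0) (ψ := φ) (s := t)
      (t := t) (d := -d) one_pos fun α u h => ⟨_, (hr α u h).neg, fun n => by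
        rw [toL2_zero, sub_zero, mul_one, normSqH_sub_toL2_eq ((h.solution n).mem t ht) hsm]
        linarith⟩
    rw [EReal.coe_one, mul_one, EReal.coe_neg, ← sub_eq_add_neg] at h1
    exact (EReal.le_sub_iff_add_le (by simp) (by simp)).1 h1

/-- The relative energy estimate along each sequence, fed into the comparison principle: `c` is the
Gronwall weight, and the rest converges since the integrals do and `√αₙ B → 0`. -/
theorem M_le_exp_mul (hγ : 0 < γ) (hũ : ∀ t, 0 ≤ t → ũ t ∈ H0) (hφ : IsTestField φ) {a b : ℝ}
    (ha : 0 ≤ a) (hab : a ≤ b) :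
    M γ g ũ φ b ≤ M γ g ũ φ a * ((Real.exp (-2 * ∫ s in a..b, (γ - e0 φ s)) : ℝ) : EReal)
      - ((2 * ∫ τ in a..b, dissIntegrand γ g ũ φ b τ : ℝ) : EReal) := by
  rw [sub_eq_add_neg, ← EReal.coe_neg]
  refine M_le_mul_add (Real.exp_pos _) fun α u h => ?_
  obtain ⟨C, -, hC⟩ := h.exists_bound_relative hγ hφ.isSmoothCurve b
  obtain ⟨B, hB⟩ := relative_energy_le hφ ha hab γ g C
  refine ⟨_, ?_, fun n => hB (α n) (u n) (h.pos n) (h.solution n)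
    fun s hs => hC n s (ha.trans hs.1) hs.2⟩
  have h1 := (h.integrable_and_tendsto_integral_dissIntegrand hγ hũ hφ.isSmoothCurve ha hab).2
  have h2 : Tendsto (fun n => Real.sqrt (α n)) atTop (𝓝 0) := by
    simpa using h.tendsto_zero.sqrt
  simpa using (h1.const_mul (-2)).add (h2.mul_const B)

end Functional

end DampedEuler

open DampedEuler
theorem mainTheorem5 (γ : ℝ) (hγ : 0 < γ) (g : L2) (ũ : ℝ → L2) (hu : ũ ∈ K0plus γ g)
    (φ : ℝ → Torus → E3) (hφ : IsTestField φ) :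
    (∀ t, 0 ≤ t → M γ g ũ φ t ≠ ⊤)
    ∧ (∀ t, 0 ≤ t → ((‖ũ t - toL2 (φ t)‖ ^ 2 : ℝ) : EReal) ≤ M γ g ũ φ t)
    ∧ (∀ t, 0 ≤ t → M γ g ũ φ t
        = M γ g ũ (fun _ _ => 0) t
          + ((‖toL2 (φ t)‖ ^ 2 - 2 * inner ℝ (ũ t) (toL2 (φ t)) : ℝ) : EReal))
    ∧ (∀ t h, 0 ≤ t → 0 ≤ h → M γ g (shift h ũ) (shift h φ) t ≤ M γ g ũ φ (t + h))
    ∧ (∀ t κ, 0 ≤ t → 0 ≤ κ →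
        IntervalIntegrable (e0 φ) volume t (t + κ)
        ∧ IntervalIntegrable (dissIntegrand γ g ũ φ (t + κ)) volume t (t + κ)
        ∧ M γ g ũ φ (t + κ)
          ≤ M γ g ũ φ t * ((Real.exp (-2 * ∫ s in t..(t + κ), (γ - e0 φ s)) : ℝ) : EReal)
            - ((2 * ∫ τ in t..(t + κ), dissIntegrand γ g ũ φ (t + κ) τ : ℝ) : EReal)) := by
  obtain ⟨hũ, α, u, h⟩ := hu
  have hφc := hφ.isSmoothCurve
  refine ⟨fun t ht => M_ne_top hγ h hφc ht, fun t ht => norm_sq_le_M hũ φ ht,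
    fun t ht => M_eq_add hγ hũ hφc ht, fun t k _ hk => M_shift_le hγ φ t hk, fun t κ ht hκ => ?_⟩
  have hle : t ≤ t + κ := le_add_of_nonneg_right hκ
  exact ⟨intervalIntegrable_e0 hφc ht (ht.trans hle),
    (h.integrable_and_tendsto_integral_dissIntegrand hγ hũ hφc ht hle).1,
    M_le_exp_mul hγ hũ hφ ht hle⟩
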